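/- **Conventions.** Let $X$ be a proper geodesic metric space with basepoint $p$. A *Morse gauge* is a function $N\colon[1,\infty)\times[0,\infty)\to[0,\infty)$; gauges are ordered pointwise. A geodesic is *$N$-Morse* if for it and each of its subgeodesics $\gamma$, every finite $(\lambda,\varepsilon)$-quasi-geodesic with endpoints on $\gamma$ lies in the $N(\lambda,\varepsilon)$-neighborhood of $\gamma$. Two rays are asymptotic if they are at finite Hausdorff distance. Let $\partial_vX_p$ be the set of asymptotic classes of geodesic rays based at $p$, where $B\subseteq\partial_vX_p$ is closed iff $b\in B$ whenever there are rays $\beta_n$ based at $p$ with $[\beta_n]\in B$ such that every subsequence of $(\beta_n)$ has a subsequence converging uniformly on compact sets to a ray in $b$. Let $\partial^NX_p\subseteq\partial_vX_p$ be the subspace of classes containing an $N$-Morse ray based at $p$. The *Morse boundary* is $\partial X=\partial_MX_p=\bigcup_N\partial^NX_p$ with the direct limit topology. For $n\ge2$ let $\partial X^{(n,N)}$ be the set of $n$-tuples of pairwise distinct points of $\partial X$ such that every bi-infinite geodesic between two of them is $N$-Morse. For $K>0$, let $m_X^{N,K}(a,b,c)$, $(a,b,c)\in\partial X^{(3,N)}$,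 be the set of *$K$-centers* of $(a,b,c)$: points of $X$ within $K$ of all sides of some geodesic triangle with vertices $a,b,c$. For each $N$ fix a constant $K_N>0$ such that every ideal geodesic triangle with $N$-Morse sides has a $K_N$-internal triple, i.e. three points, one on each side, pairwise at most $K_N$ apart (such constants exist). The *$N$-cross-ratio* of $(a,b,c,d)\in\partial X^{(4,N)}$ is $[a,b,c,d]_N=\operatorname{diam}\big(m_X^{N,K_N}(a,b,c)\cup m_X^{N,K_N}(a,d,c)\big)$. $X$ is a *Morse center space* if for some $N$ and $K>0$ every point of $X$ is a $K$-center of some tuple in $\partial X^{(3,N)}$. $X$ has the *small cross-ratio property* if for each $N$ there is $C>0$ such that for all $(a,b,c,d)\in\partial X^{(4,N)}$ at least one of $[a,b,c,d]_N$, $[a,c,b,d]_N$, $[b,a,c,d]_N$ is less than $C$. A map $h\colon\partial X\to\partial Y$ is *2-stable* if for each $N$ there is $N'$ with $h(\partial X^{(2,N)})\subseteq\partial Y^{(2,N')}$; a 2-stable map $h$ is *quasi-möbius* if for all $N,N'$ with $h(\partial X^{(2,N)})\subseteq\partial Y^{(2,N')}$ there is a continuous increasing $\psi\colon[0,\infty)\to[0,\infty)$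 with $[h(a),h(b),h(c),h(d)]_{N'}\le\psi([a,b,c,d]_N)$ for all $(a,b,c,d)\in\partial X^{(4,N)}$. **Theorem.** Let $X$ and $Y$ be proper geodesic Morse center spaces with the small cross-ratio property and with basepoints $p\in X$, $r\in Y$. Let $h\colon\partial X\to\partial Y$ be a homeomorphism such that $h$ and $h^{-1}$ are 2-stable and quasi-möbius. Then there are Morse gauges $N\le N_h$ and a constant $K_0$ such that $h(\partial X^{(3,N)})\subseteq\partial Y^{(3,N_h)}$ and, for all $K\ge K_0$, every point of $X$ is a $K$-center of some tuple in $\partial X^{(3,N)}$ and every point of $Y$ is a $K$-center of some tuple in $\partial Y^{(3,N)}$. Fix any such $N,N_h,K_0$. For $K\ge\max\{K_0,K_{N_h}\}$ (with $K_{N_h}$ the constant for $Y$) there is a map $f_K\colon X\to Y$ with $f_K(p)=r$ that sends each $x\ne p$ to a $K$-center of $(h(a),h(b),h(c))$ for some $(a,b,c)\in\partial X^{(3,N)}$ having $x$ as a $K$-center. For all sufficiently large $K$, every such map $f_K$ is a quasi-isometry and $h=(f_K)_*$, where $(f_K)_*\colon\partial_MX_p\to\partial_MY_r$ is the induced map: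 it sends the class of a ray $\gamma$ to the class of the geodesic rays based at $r$ that are at finite Hausdorff distance from $f_K(\gamma)$. -/

import Mathlib

open Set Filter Topology
open scoped NNReal ENNReal

namespace MorseBoundaries

/-! ### Coarse geometry -/

/-- Any two points are joined by a geodesic segment. -/
def IsGeodesicSpace (X : Type*) [MetricSpace X] : Prop :=
  ∀ x y : X, ∃ γ : ℝ → X, γ 0 = x ∧ γ (dist x y) = y ∧
    ∀ s ∈ Icc 0 (dist x y), ∀ t ∈ Icc 0 (dist x y), dist (γ s) (γ t) = dist s t

/-- The restriction of `f` to `S` is an `(l, e)`-quasi-isometric embedding. -/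
def IsQIEmbeddingOn {A B : Type*} [MetricSpace A] [MetricSpace B] (l e : ℝ) (f : A → B)
    (S : Set A) : Prop :=
  ∀ x ∈ S, ∀ y ∈ S,
    1 / l * dist x y - e ≤ dist (f x) (f y) ∧ dist (f x) (f y) ≤ l * dist x y + e

/-- A quasi-isometric embedding that has a quasi-inverse. -/
def IsQuasiIsometry {A B : Type*} [MetricSpace A] [MetricSpace B] (f : A → B) : Prop :=
  (∃ l e : ℝ, 1 ≤ l ∧ 0 ≤ e ∧ IsQIEmbeddingOn l e f univ) ∧
    ∃ (g : B → A) (D : ℝ), 0 ≤ D ∧ (∀ x, dist (g (f x)) x ≤ D) ∧ ∀ y, dist (f (g y)) y ≤ D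

/-- Two subsets at finite Hausdorff distance. -/
def FiniteHausdorff {X : Type*} [MetricSpace X] (S T : Set X) : Prop :=
  Metric.hausdorffEDist S T ≠ ⊤

/-- Morse gauges, i.e. functions `[1, ∞) × [0, ∞) → [0, ∞)`, with the pointwise order. -/
abbrev MorseGauge : Type := Set.Ici (1 : ℝ) → Set.Ici (0 : ℝ) → ℝ≥0

/-- A geodesic `γ` (an isometric embedding of `ι = ℝ≥0` for a ray, of `ι = ℝ` for a bi-infinite
geodesic) is `N`-Morse. As usual the gauge is required to work for all subgeodesics as well:
for each closed interval `J ⊆ ι` (in particular for `J = ι`), every finite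
`(l, e)`-quasi-geodesic with endpoints on `γ(J)` lies in the `N(l, e)`-neighbourhood of `γ(J)`. -/
def IsMorse {X ι : Type*} [MetricSpace X] [Preorder ι] [TopologicalSpace ι]
    (N : MorseGauge) (γ : ι → X) : Prop :=
  ∀ J : Set ι, IsClosed J → J.OrdConnected →
    ∀ (l : Set.Ici (1 : ℝ)) (e : Set.Ici (0 : ℝ)) (a b : ℝ) (β : ℝ → X), a ≤ b →
      IsQIEmbeddingOn l e β (Icc a b) → β a ∈ γ '' J → β b ∈ γ '' J →
        ∀ t ∈ Icc a b, ∃ s ∈ J, dist (β t) (γ s) ≤ N l e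

/-! ### The Morse boundary -/

/-- Geodesic rays based at `p`. -/
structure GeodesicRay {X : Type*} [MetricSpace X] (p : X) where
  toFun : ℝ≥0 → X
  isometry : Isometry toFun
  map_zero : toFun 0 = p

variable {X : Type*} [MetricSpace X]

/-- Two rays are equivalent if they are asymptotic, i.e. at finite Hausdorff distance. -/
instance asymptoticSetoid (p : X) : Setoid (GeodesicRay p) where
  r α β := FiniteHausdorff (range α.toFun) (range β.toFun)
  iseqv :=
    { refl := fun α => by simp [FiniteHausdorff]
      symm := fun {α β} h => by
        unfold FiniteHausdorff at *
        rwa [Metric.hausdorffEDist_comm]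
      trans := fun {α β γ} h₁ h₂ => by
        unfold FiniteHausdorff at *
        exact ne_top_of_le_ne_top (ENNReal.add_ne_top.2 ⟨h₁, h₂⟩)
          Metric.hausdorffEDist_triangle }

/-- Asymptotic classes of geodesic rays based at `p`. -/
def VisualBoundary (p : X) : Type _ := Quotient (asymptoticSetoid p)

/-- The asymptotic class of a ray. -/
def rayClass {p : X} (α : GeodesicRay p) : VisualBoundary p := Quotient.mk _ α

/-- The sequence of rays `β` converges to the ray `β'` uniformly on compact sets. -/
def ConvergesOnCompacts {p : X} (β : ℕ → GeodesicRay p) (β' : GeodesicRay p) : Prop :=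
  ∀ S : Set ℝ≥0, IsCompact S → TendstoUniformlyOn (fun n => (β n).toFun) β'.toFun atTop S

/-- Every subsequence of `β` contains a subsequence that converges uniformly on compact sets to
some ray in the class `b`. -/
def SubconvergesTo {p : X} (β : ℕ → GeodesicRay p) (b : VisualBoundary p) : Prop :=
  ∀ φ : ℕ → ℕ, StrictMono φ → ∃ ψ : ℕ → ℕ, StrictMono ψ ∧
    ∃ β' : GeodesicRay p, rayClass β' = b ∧ ConvergesOnCompacts (fun n => β (φ (ψ n))) β'

/-- The closed subsets of the visual boundary. -/
def IsVisualClosed {p : X} (B : Set (VisualBoundary p)) : Prop :=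
  ∀ (β : ℕ → GeodesicRay p) (b : VisualBoundary p),
    (∀ n, rayClass (β n) ∈ B) → SubconvergesTo β b → b ∈ B

theorem SubconvergesTo.comp {p : X} {β : ℕ → GeodesicRay p} {b : VisualBoundary p}
    (h : SubconvergesTo β b) {φ : ℕ → ℕ} (hφ : StrictMono φ) :
    SubconvergesTo (fun n => β (φ n)) b :=
  fun φ' hφ' => h (fun n => φ (φ' n)) (hφ.comp hφ')

theorem IsVisualClosed.union {p : X} {B C : Set (VisualBoundary p)}
    (hB : IsVisualClosed B) (hC : IsVisualClosed C) : IsVisualClosed (B ∪ C) := by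
  intro β b hβ hb
  by_cases hfr : ∃ᶠ n in atTop, rayClass (β n) ∈ B
  · obtain ⟨φ, hφ, hφB⟩ := extraction_of_frequently_atTop hfr
    exact Or.inl (hB _ b hφB (hb.comp hφ))
  · have hC' : ∀ᶠ n in atTop, rayClass (β n) ∈ C := by
      filter_upwards [not_frequently.1 hfr] with n hn
      exact (hβ n).resolve_left hn
    obtain ⟨φ, hφ, hφC⟩ := extraction_of_eventually_atTop hC'
    exact Or.inr (hC _ b hφC (hb.comp hφ))

instance (p : X) : TopologicalSpace (VisualBoundary p) :=
  TopologicalSpace.ofClosed {B | IsVisualClosed B}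
    (fun _ _ hβ _ => (hβ 0).elim)
    (fun _ hA β b hβ hb B hB => hA hB β b (fun n => hβ n B hB) hb)
    (fun _ hB _ hC => IsVisualClosed.union hB hC)

/-- The stratum of all classes that contain an `N`-Morse geodesic ray based at `p`. -/
def stratum (p : X) (N : MorseGauge) : Set (VisualBoundary p) :=
  {x | ∃ α : GeodesicRay p, rayClass α = x ∧ IsMorse N α.toFun}

/-- The Morse boundary with basepoint `p`: as a set, the union of the strata. -/
def MorseBoundary (p : X) : Type _ := {x : VisualBoundary p // ∃ N, x ∈ stratum p N}

/-- The inclusion of a stratum. -/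
def stratumInclusion (p : X) (N : MorseGauge) (x : stratum p N) : MorseBoundary p :=
  ⟨x.1, N, x.2⟩

/-- The direct limit topology: the finest topology for which all inclusions of strata, with their
subspace topologies from the visual boundary, are continuous. -/
instance (p : X) : TopologicalSpace (MorseBoundary p) :=
  ⨆ N : MorseGauge, TopologicalSpace.coinduced (stratumInclusion p N) inferInstance

/-- The ray `α` represents the boundary point `a`. -/
def Represents {p : X} (α : GeodesicRay p) (a : MorseBoundary p) : Prop := rayClass α = a.1

/-! ### Ideal triangles and their centers -/

/-- `γ` is a bi-infinite geodesic from `a` to `b`. -/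
def IsLineFromTo {p : X} (γ : ℝ → X) (a b : MorseBoundary p) : Prop :=
  Isometry γ ∧
    (∃ α : GeodesicRay p, Represents α a ∧ FiniteHausdorff (γ '' Iic 0) (range α.toFun)) ∧
    ∃ β : GeodesicRay p, Represents β b ∧ FiniteHausdorff (γ '' Ici 0) (range β.toFun)

/-- The set of `n`-tuples of pairwise distinct boundary points such that every geodesic between
any two of them is `N`-Morse. -/
def morseTuples (p : X) (n : ℕ) (N : MorseGauge) : Set (Fin n → MorseBoundary p) :=
  {v | Function.Injective v ∧
    ∀ i j, i ≠ j → ∀ γ : ℝ → X, IsLineFromTo γ (v i) (v j) → IsMorse N γ}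

/-- `γab`, `γbc`, `γac` are the sides of a geodesic triangle with vertices `a`, `b`, `c`. -/
def IsIdealTriangle {p : X} (a b c : MorseBoundary p) (γab γbc γac : ℝ → X) : Prop :=
  IsLineFromTo γab a b ∧ IsLineFromTo γbc b c ∧ IsLineFromTo γac a c

/-- The `K`-centers of `(a, b, c)`: the points within `K` of all sides of some geodesic triangle
with vertices `a`, `b`, `c`. -/
def centers {p : X} (K : ℝ) (a b c : MorseBoundary p) : Set X :=
  {x | ∃ γab γbc γac : ℝ → X, IsIdealTriangle a b c γab γbc γac ∧
    (∃ s, dist x (γab s) ≤ K) ∧ (∃ s, dist x (γbc s) ≤ K) ∧ ∃ s, dist x (γac s) ≤ K}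

/-- Every ideal geodesic triangle with `N`-Morse sides has a `K`-internal triple, i.e. three
points, one on each side, that are pairwise at most `K` apart. -/
def IsInternalConstant (p : X) (N : MorseGauge) (K : ℝ) : Prop :=
  0 < K ∧ ∀ (a b c : MorseBoundary p) (γab γbc γac : ℝ → X),
    IsIdealTriangle a b c γab γbc γac → IsMorse N γab → IsMorse N γbc → IsMorse N γac →
      ∃ s t u : ℝ, dist (γab s) (γbc t) ≤ K ∧ dist (γbc t) (γac u) ≤ K ∧
        dist (γab s) (γac u) ≤ K

/-- `κ` is a choice, for each gauge `N`, of a constant `κ N` for which `N`-Morse ideal triangles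
have internal triples. That such constants exist is not part of the assumption: `κ N` is
required to be one of them only if there is one. -/
def IsInternalConstantChoice (p : X) (κ : MorseGauge → ℝ) : Prop :=
  ∀ N, (∃ K, IsInternalConstant p N K) → IsInternalConstant p N (κ N)

/-- Every point is a `K`-center of some triple all of whose connecting geodesics are
`N`-Morse. -/
def CoveredByCenters (p : X) (N : MorseGauge) (K : ℝ) : Prop :=
  ∀ x : X, ∃ a b c : MorseBoundary p, ![a, b, c] ∈ morseTuples p 3 N ∧ x ∈ centers K a b c

/-- Morse center spaces. -/
def IsMorseCenterSpace (p : X) : Prop :=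
  ∃ (N : MorseGauge) (K : ℝ), 0 < K ∧ CoveredByCenters p N K

/-! ### Cross-ratios -/

/-- The cross-ratio `[a, b, c, d]` computed with `K`-centers; for `(a, b, c, d)` in
`morseTuples p 4 N` the `N`-cross-ratio is the one with `K = κ N`. -/
noncomputable def crossRatio {p : X} (K : ℝ) (a b c d : MorseBoundary p) : ℝ≥0 :=
  ⟨Metric.diam (centers K a b c ∪ centers K a d c), Metric.diam_nonneg⟩

/-- The small cross-ratio property. -/
def HasSmallCrossRatios (p : X) (κ : MorseGauge → ℝ) : Prop :=
  ∀ N : MorseGauge, ∃ C : ℝ, 0 < C ∧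
    ∀ a b c d : MorseBoundary p, ![a, b, c, d] ∈ morseTuples p 4 N →
      crossRatio (κ N) a b c d < C ∨ crossRatio (κ N) a c b d < C ∨
        crossRatio (κ N) b a c d < C

variable {Y : Type*} [MetricSpace Y]

/-- `h` maps tuples in `morseTuples p n N` to tuples in `morseTuples r n N'`. -/
def MapsTuples {p : X} {r : Y} (n : ℕ) (N N' : MorseGauge)
    (h : MorseBoundary p → MorseBoundary r) : Prop :=
  ∀ v ∈ morseTuples p n N, (fun i => h (v i)) ∈ morseTuples r n N'

/-- `h` is 2-stable. -/
def IsTwoStable {p : X} {r : Y} (h : MorseBoundary p → MorseBoundary r) : Prop :=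
  ∀ N, ∃ N', MapsTuples 2 N N' h

/-- `h` is quasi-möbius. -/
def IsQuasiMoebius {p : X} {r : Y} (κX κY : MorseGauge → ℝ)
    (h : MorseBoundary p → MorseBoundary r) : Prop :=
  ∀ N N', MapsTuples 2 N N' h →
    ∃ ψ : ℝ≥0 → ℝ≥0, Continuous ψ ∧ Monotone ψ ∧
      ∀ a b c d : MorseBoundary p, ![a, b, c, d] ∈ morseTuples p 4 N →
        crossRatio (κY N') (h a) (h b) (h c) (h d) ≤ ψ (crossRatio (κX N) a b c d)

/-! ### The maps `f_K` and induced boundary maps -/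

/-- The gauges `N ≤ N_h` and the constant `K₀` that enter into the construction of the maps
`f_K`. -/
structure IsConstructionData {p : X} {r : Y} (h : MorseBoundary p → MorseBoundary r)
    (N Nh : MorseGauge) (K₀ : ℝ) : Prop where
  coverX : ∀ K, K₀ ≤ K → CoveredByCenters p N K
  coverY : ∀ K, K₀ ≤ K → CoveredByCenters r N K
  le : N ≤ Nh
  maps : MapsTuples 3 N Nh h

/-- `f` is one of the maps `f_K`: it sends `p` to `r`, and it sends each `x ≠ p` to a `K`-center
of `(h a, h b, h c)` for some `(a, b, c)` in `morseTuples p 3 N` that has `x` as a `K`-center. -/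
def IsCenterMap {p : X} {r : Y} (h : MorseBoundary p → MorseBoundary r)
    (N : MorseGauge) (K : ℝ) (f : X → Y) : Prop :=
  f p = r ∧ ∀ x, x ≠ p → ∃ a b c : MorseBoundary p,
    ![a, b, c] ∈ morseTuples p 3 N ∧ x ∈ centers K a b c ∧ f x ∈ centers K (h a) (h b) (h c)

/-- `φ` is the boundary map `f_*` induced by `f` (where `f p = r`): the image under `f` of a ray
representing `a` is at finite Hausdorff distance from the rays representing `φ a`. -/
def IsInducedBoundaryMap {p : X} {r : Y} (f : X → Y)
    (φ : MorseBoundary p → MorseBoundary r) : Prop :=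
  f p = r ∧ ∀ (a : MorseBoundary p) (α : GeodesicRay p) (β : GeodesicRay r),
    Represents α a → Represents β (φ a) → FiniteHausdorff (f '' range α.toFun) (range β.toFun)

/-- There is at most one induced boundary map. -/
theorem IsInducedBoundaryMap.unique {p : X} {r : Y} {f : X → Y}
    {φ φ' : MorseBoundary p → MorseBoundary r} (hφ : IsInducedBoundaryMap f φ)
    (hφ' : IsInducedBoundaryMap f φ') : φ = φ' := by
  funext a
  obtain ⟨_, α, hα, -⟩ := a.2
  obtain ⟨_, β, hβ, -⟩ := (φ a).2
  obtain ⟨_, β', hβ', -⟩ := (φ' a).2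
  have h₁ := hφ.2 a α β hα hβ
  have h₂ := hφ'.2 a α β' hα hβ'
  have h₃ : rayClass β = rayClass β' := by
    refine Quotient.sound (s := asymptoticSetoid r) ?_
    change FiniteHausdorff _ _
    unfold FiniteHausdorff at *
    rw [Metric.hausdorffEDist_comm] at h₁
    exact ne_top_of_le_ne_top (ENNReal.add_ne_top.2 ⟨h₁, h₂⟩) Metric.hausdorffEDist_triangle
  exact Subtype.ext (hβ.symm.trans (h₃.trans hβ'))

end MorseBoundaries

open MorseBoundaries

namespace MorseBoundaries

variable {X : Type*} [MetricSpace X] {Y : Type*} [MetricSpace Y] {p : X} {r : Y}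

/-! ### Quasi-geodesics -/

/-! The heart is that a center map is determined up to bounded error. If `x` is a `K`-center of two
`N`-Morse triples `T` and `T'`, then the centers of `h T` and `h T'` are uniformly close
(`exists_dist_centers_le`). Each of the six boundary points is the end of a Morse ray starting near
`x`, so all lines between them share one gauge depending only on `N` and `K` (`isMorse_of_rays`,
`Anchored.pairMorse`). Slimness of ideal triangles (`NearLine.or`) shows that `x` is near the line
from `T i` to `T' k`, except for at most one `k` for each `i` and at most one `i` for each `k`. A
matching argument (`exists_matching`) then lets the vertices of `T` be exchanged one at a time for
those of `T'` while `x` stays a center. One exchange is controlled by a cross-ratio: it is bounded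
in `X` because center sets have bounded diameter (`dist_le_of_mem_centers`), so it is bounded in `Y`
by the quasi-möbius inequality.

The rest follows formally. A center of a triple is also a coarser center at each nearby point, so
center maps are coarsely Lipschitz. A center map `g` for the inverse of `h` satisfies `g (f x) ≈ x`,
because `f x` is near a center of `h T`, whose preimage triple `T` has `x` as a center; the same
holds in the other order. Hence `f` is a quasi-isometry.

For the boundary map, let `ρ` be a ray to `a` and let `b ≠ a`. The points of `ρ` are near a line
from `a` to `b`, and slimness makes each of them a center of `a`, `b` and a third point. So `f` maps
them near lines from `h a` to `h b` (`IsCoarseCenterMap.exists_nearLine`). Doing this for two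
different `b` confines `f ∘ ρ` to a neighbourhood of a ray to `h a`.

The geometry underneath rests on `MorseSet.fellow_travel`: closeness with an unknown constant
improves to closeness with a constant depending only on the gauge. This is why all later bounds are
uniform. -/

theorem one_div_mul_sub_le_iff {l d e D : ℝ} (hl : 0 < l) :
    1 / l * d - e ≤ D ↔ d ≤ l * (D + e) := by
  rw [sub_le_iff_le_add, one_div, inv_mul_le_iff₀ hl]

theorem isQIEmbeddingOn_of_le {l e : ℝ} (hl : 0 < l) {f : ℝ → X} {S : Set ℝ}
    (h : ∀ s ∈ S, ∀ t ∈ S, s ≤ t →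
      t - s ≤ l * (dist (f s) (f t) + e) ∧ dist (f s) (f t) ≤ l * (t - s) + e) :
    IsQIEmbeddingOn l e f S := by
  intro s hs t ht
  rw [one_div_mul_sub_le_iff hl]
  rcases le_total s t with hst | hst
  · rw [Real.dist_eq, abs_sub_comm, abs_of_nonneg (sub_nonneg.2 hst)]
    exact h s hs t ht hst
  · rw [Real.dist_eq, abs_of_nonneg (sub_nonneg.2 hst), dist_comm (f s)]
    exact h t ht s hs hst

theorem IsQIEmbeddingOn.of_le {l e : ℝ} (hl : 0 < l) {f : ℝ → X} {S : Set ℝ}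
    (h : IsQIEmbeddingOn l e f S) {s t : ℝ} (hs : s ∈ S) (ht : t ∈ S) (hst : s ≤ t) :
    t - s ≤ l * (dist (f s) (f t) + e) ∧ dist (f s) (f t) ≤ l * (t - s) + e := by
  have := h s hs t ht
  rwa [one_div_mul_sub_le_iff hl, Real.dist_eq, abs_sub_comm,
    abs_of_nonneg (sub_nonneg.2 hst)] at this

theorem IsQIEmbeddingOn.perturb {A B : Type*} [MetricSpace A] [MetricSpace B] {l e D : ℝ}
    {f f' : A → B} {S : Set A} (h : IsQIEmbeddingOn l e f S)
    (hf : ∀ x ∈ S, dist (f' x) (f x) ≤ D) : IsQIEmbeddingOn l (e + 2 * D) f' S := by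
  intro x hx y hy
  have h₁ := h x hx y hy
  have h₂ := dist_triangle4 (f x) (f' x) (f' y) (f y)
  have h₃ := dist_triangle4 (f' x) (f x) (f y) (f' y)
  have h₄ := hf x hx
  have h₅ := hf y hy
  rw [dist_comm] at h₂ h₃
  rw [dist_comm (f y)] at h₃
  rw [dist_comm (f x) (f' x)] at h₂
  rw [dist_comm (f' y) (f' x)] at h₃
  rw [dist_comm (f y) (f x)] at h₂
  constructor <;> linarith

theorem IsQIEmbeddingOn.comp_neg {l e a b : ℝ} {β : ℝ → X}
    (h : IsQIEmbeddingOn l e β (Icc a b)) :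
    IsQIEmbeddingOn l e (fun t => β (-t)) (Icc (-b) (-a)) := by
  intro s hs t ht
  have := h (-s) ⟨by linarith [hs.2], by linarith [hs.1]⟩ (-t)
    ⟨by linarith [ht.2], by linarith [ht.1]⟩
  rwa [dist_neg_neg] at this

/-- `f` is a geodesic on `S`. -/
def IsGeodesicOn (f : ℝ → X) (S : Set ℝ) : Prop :=
  ∀ s ∈ S, ∀ t ∈ S, dist (f s) (f t) = dist s t

theorem IsGeodesicOn.mono {f : ℝ → X} {S T : Set ℝ} (h : IsGeodesicOn f T) (hST : S ⊆ T) :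
    IsGeodesicOn f S :=
  fun x hx y hy => h x (hST hx) y (hST hy)

theorem IsGeodesicOn.isQIEmbeddingOn {f : ℝ → X} {S : Set ℝ} (h : IsGeodesicOn f S) :
    IsQIEmbeddingOn 1 0 f S := by
  intro x hx y hy
  simp [h x hx y hy]

theorem IsGeodesicOn.of_le {f : ℝ → X} {S : Set ℝ} (h : IsGeodesicOn f S) {s t : ℝ} (hs : s ∈ S)
    (ht : t ∈ S) (hst : s ≤ t) : dist (f s) (f t) = t - s := by
  rw [h s hs t ht, Real.dist_eq, abs_sub_comm, abs_of_nonneg (sub_nonneg.2 hst)]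

theorem isGeodesicOn_of_isometry {f : ℝ → X} (h : Isometry f) (S : Set ℝ) : IsGeodesicOn f S :=
  fun s _ t _ => h.dist_eq s t

/-- A property that holds at `a` but not at `b` changes somewhere in between. -/
theorem exists_change {P : ℝ → Prop} {a b : ℝ} (hab : a ≤ b) (ha : P a) (hb : ¬ P b) {ε : ℝ}
    (hε : 0 < ε) : ∃ s ∈ Icc a b, ∃ t ∈ Icc a b, s ≤ t ∧ t ≤ s + ε ∧ P s ∧ ¬ P t := by
  set A : Set ℝ := {t | t ∈ Icc a b ∧ P t} with hA
  have hne : A.Nonempty := ⟨a, ⟨le_rfl, hab⟩, ha⟩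
  have hbd : BddAbove A := ⟨b, fun t ht => ht.1.2⟩
  obtain ⟨s, hsA, hs⟩ := exists_lt_of_lt_csSup hne (sub_lt_self (sSup A) (half_pos hε))
  have hsup : s ≤ sSup A := le_csSup hbd hsA
  rcases le_total b (s + ε) with hb' | hb'
  · exact ⟨s, hsA.1, b, ⟨hab, le_rfl⟩, hsA.1.2, hb', hsA.2, hb⟩
  · refine ⟨s, hsA.1, s + ε, ⟨by linarith [hsA.1.1], hb'⟩, by linarith, le_rfl, hsA.2, ?_⟩
    intro hP
    have := le_csSup hbd (show s + ε ∈ A from ⟨⟨by linarith [hsA.1.1], hb'⟩, hP⟩)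
    linarith

/-- Quasi-geodesics need not be continuous, so the infimum may not be attained; the slack 1 replaces
a nearest point. -/
theorem exists_almost_nearest (β : ℝ → X) (x : X) {a b : ℝ} (hab : a ≤ b) :
    ∃ t₀ ∈ Icc a b, ∀ t ∈ Icc a b, dist x (β t₀) ≤ dist x (β t) + 1 := by
  have hne : ((fun t => dist x (β t)) '' Icc a b).Nonempty := ⟨_, a, ⟨le_rfl, hab⟩, rfl⟩
  obtain ⟨_, ⟨t₀, ht₀, rfl⟩, h⟩ := exists_lt_of_csInf_lt hne
    (lt_add_one (sInf ((fun t => dist x (β t)) '' Icc a b)))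
  refine ⟨t₀, ht₀, fun t ht => h.le.trans ?_⟩
  gcongr
  exact csInf_le ⟨0, by rintro _ ⟨t, -, rfl⟩; exact dist_nonneg⟩ ⟨t, ht, rfl⟩

/-- A geodesic from `x` to an almost nearest point of a quasi-geodesic, followed by the
quasi-geodesic, is a quasi-geodesic. -/
theorem exists_concat_left (hX : IsGeodesicSpace X) {l e a b : ℝ} {β : ℝ → X} (hl : 1 ≤ l)
    (he : 0 ≤ e) (hβ : IsQIEmbeddingOn l e β (Icc a b)) {x : X} {t₀ : ℝ} (ht₀ : t₀ ∈ Icc a b)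
    (hmin : ∀ t ∈ Icc a b, dist x (β t₀) ≤ dist x (β t) + 1) :
    ∃ β' : ℝ → X, β' (t₀ - dist x (β t₀)) = x ∧ (∀ t, t₀ ≤ t → β' t = β t) ∧
      IsQIEmbeddingOn (3 * l) (e + 2) β' (Icc (t₀ - dist x (β t₀)) b) := by
  obtain ⟨σ, h0, h1, hσ⟩ := hX x (β t₀)
  set d := dist x (β t₀) with hd
  have hd0 : 0 ≤ d := dist_nonneg
  refine ⟨fun t => if t ≤ t₀ then σ (t - (t₀ - d)) else β t, ?_, ?_, ?_⟩
  · simp [hd0, h0]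
  · intro t ht
    rcases ht.eq_or_lt with rfl | ht
    · simp [h1]
    · simp [not_le.2 ht]
  apply isQIEmbeddingOn_of_le (by linarith)
  intro s hs t ht hst
  by_cases ht' : t ≤ t₀
  · have hs' : s ≤ t₀ := hst.trans ht'
    have : dist (σ (s - (t₀ - d))) (σ (t - (t₀ - d))) = t - s := by
      rw [hσ _ ⟨by linarith [hs.1], by linarith⟩ _ ⟨by linarith [ht.1], by linarith⟩,
        Real.dist_eq, abs_sub_comm, abs_of_nonneg (by linarith)]
      ring
    simp only [ht', hs', if_true, this]
    have hst' : 0 ≤ t - s := sub_nonneg.2 hst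
    constructor <;> nlinarith
  · push Not at ht'
    have htI : t ∈ Icc a b := ⟨by linarith [ht₀.1], ht.2⟩
    by_cases hs' : s ≤ t₀
    · simp only [not_le.2 ht', hs', if_true, if_false]
      set z := σ (s - (t₀ - d)) with hz
      have hsI : s - (t₀ - d) ∈ Icc 0 d := ⟨by linarith [hs.1], by linarith⟩
      have hzx : dist x z = s - (t₀ - d) := by
        rw [hz, ← h0, hσ _ ⟨le_rfl, hd0⟩ _ hsI, dist_comm, Real.dist_0_eq_abs,
          abs_of_nonneg hsI.1]
      have hzy : dist z (β t₀) = t₀ - s := by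
        rw [hz, ← h1, hσ _ hsI _ ⟨hd0, le_rfl⟩, Real.dist_eq, abs_sub_comm,
          abs_of_nonneg (by linarith)]
        ring
      have h₁ := hmin t htI
      have h₂ := dist_triangle x z (β t)
      have h₃ := dist_triangle (β t₀) z (β t)
      have h₄ := dist_triangle z (β t₀) (β t)
      rw [dist_comm (β t₀) z] at h₃
      obtain ⟨h₅, h₆⟩ := hβ.of_le (by linarith) ht₀ htI ht'.le
      -- Since `z` lies on a geodesic from `x` to `β t₀`, the point `β t₀` is almost nearest to `z`
      -- too. So `t₀ - s` is at most `dist z (β t) + 1`, and `β t₀` is within `2 * dist z (β t) + 1`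
      -- of `β t`; the sum yields the factor `3 * l`.
      have h₇ : t - t₀ ≤ l * (2 * dist z (β t) + 1 + e) :=
        h₅.trans (mul_le_mul_of_nonneg_left (by linarith) (by linarith))
      constructor
      · nlinarith
      · nlinarith
    · push Not at hs'
      simp only [not_le.2 ht', not_le.2 hs', if_false]
      obtain ⟨h₅, h₆⟩ := hβ.of_le (by linarith) (s := s) (t := t) ⟨by linarith [ht₀.1], hs.2⟩ htI hst
      have : 0 ≤ dist (β s) (β t) := dist_nonneg
      constructor <;> nlinarith

theorem exists_concat_right (hX : IsGeodesicSpace X) {l e a b : ℝ} {β : ℝ → X} (hl : 1 ≤ l)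
    (he : 0 ≤ e) (hβ : IsQIEmbeddingOn l e β (Icc a b)) {x : X} {t₀ : ℝ} (ht₀ : t₀ ∈ Icc a b)
    (hmin : ∀ t ∈ Icc a b, dist x (β t₀) ≤ dist x (β t) + 1) :
    ∃ β' : ℝ → X, β' (t₀ + dist x (β t₀)) = x ∧ (∀ t, t ≤ t₀ → β' t = β t) ∧
      IsQIEmbeddingOn (3 * l) (e + 2) β' (Icc a (t₀ + dist x (β t₀))) := by
  obtain ⟨β', h1, h2, h3⟩ := exists_concat_left hX hl he hβ.comp_neg (x := x) (t₀ := -t₀)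
    ⟨by linarith [ht₀.2], by linarith [ht₀.1]⟩ (by
      intro t ht
      simpa using hmin (-t) ⟨by linarith [ht.2], by linarith [ht.1]⟩)
  rw [neg_neg] at h1 h3
  refine ⟨fun t => β' (-t), ?_, ?_, ?_⟩
  · simpa only [neg_add'] using h1
  · intro t ht
    simp [h2 (-t) (by linarith)]
  · convert h3.comp_neg using 2 <;> ring

/-! ### Morse sets -/

/-- Every finite quasi-geodesic with endpoints in `S` stays close to `S`, as specified by `g`. -/
def MorseSet (g : ℝ → ℝ → ℝ) (S : Set X) : Prop :=
  ∀ (l e a b : ℝ) (β : ℝ → X), 1 ≤ l → 0 ≤ e → a ≤ b → IsQIEmbeddingOn l e β (Icc a b) →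
    β a ∈ S → β b ∈ S → ∀ t ∈ Icc a b, ∃ s ∈ S, dist (β t) s ≤ g l e

theorem MorseSet.mono {g g' : ℝ → ℝ → ℝ} {S : Set X} (hS : MorseSet g S)
    (hg : ∀ l e, 1 ≤ l → 0 ≤ e → g l e ≤ g' l e) : MorseSet g' S := by
  intro l e a b β hl he hab hβ ha hb t ht
  obtain ⟨s, hs, hd⟩ := hS l e a b β hl he hab hβ ha hb t ht
  exact ⟨s, hs, hd.trans (hg l e hl he)⟩

/-- Only the two endpoint values are moved into `S`, which is allowed because no continuity is
required and costs `2 * D` in the additive constant. The maximum with `D` covers the endpoints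
themselves. -/
theorem MorseSet.near {g : ℝ → ℝ → ℝ} {S : Set X} (hS : MorseSet g S) {D l e a b : ℝ}
    {β : ℝ → X} (hD : 0 ≤ D) (hl : 1 ≤ l) (he : 0 ≤ e) (hβ : IsQIEmbeddingOn l e β (Icc a b))
    (ha : ∃ s ∈ S, dist (β a) s ≤ D) (hb : ∃ s ∈ S, dist (β b) s ≤ D) {t : ℝ} (ht : t ∈ Icc a b) :
    ∃ s ∈ S, dist (β t) s ≤ max (g l (e + 2 * D)) D := by
  obtain ⟨u, hu, hau⟩ := ha
  obtain ⟨v, hv, hbv⟩ := hb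
  rcases ht.1.eq_or_lt with rfl | hat
  · exact ⟨u, hu, hau.trans (le_max_right _ _)⟩
  rcases ht.2.eq_or_lt with rfl | htb
  · exact ⟨v, hv, hbv.trans (le_max_right _ _)⟩
  have hab : a < b := hat.trans htb
  set β' : ℝ → X := Function.update (Function.update β a u) b v with hβ'
  have hβ'Q : IsQIEmbeddingOn l (e + 2 * D) β' (Icc a b) := by
    apply hβ.perturb
    intro x _
    by_cases hxb : x = b
    · subst hxb; simpa [hβ', dist_comm] using hbv
    · by_cases hxa : x = a
      · subst hxa; simpa [hβ', hxb, dist_comm] using hau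
      · simpa [hβ', hxa, hxb] using hD
  obtain ⟨s, hs, hd⟩ := hS l (e + 2 * D) a b β' hl (by linarith) hab.le hβ'Q
    (by simpa [hβ', hab.ne] using hu) (by simpa [hβ'] using hv) t ht
  refine ⟨s, hs, le_trans ?_ (le_max_left _ _)⟩
  simpa [hβ', hat.ne', htb.ne] using hd

theorem MorseSet.of_hausdorff {g : ℝ → ℝ → ℝ} {S S' : Set X} (hS : MorseSet g S) {D : ℝ}
    (hD : 0 ≤ D) (h₁ : ∀ x ∈ S, ∃ y ∈ S', dist x y ≤ D) (h₂ : ∀ y ∈ S', ∃ x ∈ S, dist y x ≤ D) :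
    MorseSet (fun l e => max (g l (e + 2 * D)) D + D) S' := by
  intro l e a b β hl he hab hβ ha hb t ht
  obtain ⟨s, hs, hd⟩ := hS.near hD hl he hβ (h₂ _ ha) (h₂ _ hb) ht
  obtain ⟨s', hs', hd'⟩ := h₁ s hs
  exact ⟨s', hs', (dist_triangle _ s _).trans (add_le_add hd hd')⟩

/-- The part of `β` after `t₀` also belongs to the concatenation through a geodesic from `x`, whose
endpoints are near `S`; where `β` begins is irrelevant. -/
theorem MorseSet.near_right (hX : IsGeodesicSpace X) {g : ℝ → ℝ → ℝ} {S : Set X}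
    (hS : MorseSet g S) {D l e a b : ℝ} {β : ℝ → X} {x : X} (hD : 0 ≤ D) (hl : 1 ≤ l)
    (he : 0 ≤ e) (hβ : IsQIEmbeddingOn l e β (Icc a b)) (hx : ∃ s ∈ S, dist x s ≤ D)
    (hb : β b ∈ S) {t₀ : ℝ} (ht₀ : t₀ ∈ Icc a b)
    (hmin : ∀ t ∈ Icc a b, dist x (β t₀) ≤ dist x (β t) + 1) {t : ℝ} (ht : t ∈ Icc t₀ b) :
    ∃ s ∈ S, dist (β t) s ≤ max (g (3 * l) (e + 2 + 2 * D)) D := by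
  obtain ⟨β', h1, h2, h3⟩ := exists_concat_left hX hl he hβ ht₀ hmin
  have hd : 0 ≤ dist x (β t₀) := dist_nonneg
  rw [← h2 t ht.1]
  refine hS.near hD (by linarith) (by linarith) h3 (by rwa [h1]) ?_ ⟨by linarith [ht.1], ht.2⟩
  exact ⟨β b, hb, by simpa [h2 b (ht.1.trans ht.2)] using hD⟩

theorem MorseSet.near_left (hX : IsGeodesicSpace X) {g : ℝ → ℝ → ℝ} {S : Set X}
    (hS : MorseSet g S) {D l e a b : ℝ} {β : ℝ → X} {x : X} (hD : 0 ≤ D) (hl : 1 ≤ l)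
    (he : 0 ≤ e) (hβ : IsQIEmbeddingOn l e β (Icc a b)) (hx : ∃ s ∈ S, dist x s ≤ D)
    (ha : β a ∈ S) {t₀ : ℝ} (ht₀ : t₀ ∈ Icc a b)
    (hmin : ∀ t ∈ Icc a b, dist x (β t₀) ≤ dist x (β t) + 1) {t : ℝ} (ht : t ∈ Icc a t₀) :
    ∃ s ∈ S, dist (β t) s ≤ max (g (3 * l) (e + 2 + 2 * D)) D := by
  have := hS.near_right hX hD hl he hβ.comp_neg hx (by simpa using ha) (t₀ := -t₀)
    ⟨by linarith [ht₀.2], by linarith [ht₀.1]⟩ (by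
      intro t ht
      simpa using hmin (-t) ⟨by linarith [ht.2], by linarith [ht.1]⟩) (t := -t)
    ⟨by linarith [ht.2], by linarith [ht.1]⟩
  simpa using this

/-- A gauge for the union of two Morse sets at distance at most `D`. -/
noncomputable def unionGauge (g : ℝ → ℝ → ℝ) (D : ℝ) (l e : ℝ) : ℝ :=
  max (g l e) (max (g (3 * l) (e + 2 + 2 * D)) D)

/-- Cut the quasi-geodesic at its almost nearest point to `x` and join each piece to `x`. As `x` is
close to both sets, each piece can be compared with whichever set contains its outer endpoint. -/
theorem MorseSet.union (hX : IsGeodesicSpace X) {g : ℝ → ℝ → ℝ} {S T : Set X} (hS : MorseSet g S)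
    (hT : MorseSet g T) {D : ℝ} {x y : X} (hx : x ∈ S) (hy : y ∈ T) (hxy : dist x y ≤ D) :
    MorseSet (unionGauge g D) (S ∪ T) := by
  have hD : 0 ≤ D := dist_nonneg.trans hxy
  intro l e a b β hl he hab hβ ha hb t ht
  obtain ⟨t₀, ht₀, hmin⟩ := exists_almost_nearest β x hab
  have hxS : ∃ s ∈ S, dist x s ≤ D := ⟨x, hx, by simpa using hD⟩
  have hxT : ∃ s ∈ T, dist x s ≤ D := ⟨y, hy, hxy⟩
  have key : ∃ s ∈ S ∪ T, dist (β t) s ≤ max (g (3 * l) (e + 2 + 2 * D)) D := by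
    rcases le_total t t₀ with h | h
    · rcases ha with ha | ha
      · obtain ⟨s, hs, hd⟩ := hS.near_left hX hD hl he hβ hxS ha ht₀ hmin ⟨ht.1, h⟩
        exact ⟨s, Or.inl hs, hd⟩
      · obtain ⟨s, hs, hd⟩ := hT.near_left hX hD hl he hβ hxT ha ht₀ hmin ⟨ht.1, h⟩
        exact ⟨s, Or.inr hs, hd⟩
    · rcases hb with hb | hb
      · obtain ⟨s, hs, hd⟩ := hS.near_right hX hD hl he hβ hxS hb ht₀ hmin ⟨h, ht.2⟩
        exact ⟨s, Or.inl hs, hd⟩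
      · obtain ⟨s, hs, hd⟩ := hT.near_right hX hD hl he hβ hxT hb ht₀ hmin ⟨h, ht.2⟩
        exact ⟨s, Or.inr hs, hd⟩
  obtain ⟨s, hs, hd⟩ := key
  exact ⟨s, hs, hd.trans (le_max_right _ _)⟩

/-- A geodesic with endpoints close to a Morse set is, away from its endpoints, uniformly close
to the Morse set. -/
theorem MorseSet.fellow_travel (hX : IsGeodesicSpace X) {g : ℝ → ℝ → ℝ} {S : Set X}
    (hS : MorseSet g S) {A B D₁ D₂ : ℝ} {γ : ℝ → X} (hγ : IsGeodesicOn γ (Icc A B))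
    (hA : ∃ s ∈ S, dist s (γ A) ≤ D₁) (hB : ∃ s ∈ S, dist s (γ B) ≤ D₂) {t : ℝ}
    (ht₁ : A + 2 * D₁ + 1 ≤ t) (ht₂ : t ≤ B - 6 * D₂ - 9) :
    ∃ s ∈ S, dist (γ t) s ≤ g 9 4 := by
  obtain ⟨x, hx, hxA⟩ := hA
  obtain ⟨y, hy, hyB⟩ := hB
  have hD₁ : 0 ≤ D₁ := dist_nonneg.trans hxA
  have hD₂ : 0 ≤ D₂ := dist_nonneg.trans hyB
  have hAB : A ≤ B := by linarith
  obtain ⟨t₀, ht₀, hmin⟩ := exists_almost_nearest γ x hAB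
  have h0 : t₀ - A ≤ 2 * D₁ + 1 := by
    have h1 := hmin A ⟨le_rfl, hAB⟩
    have h2 := dist_triangle (γ A) x (γ t₀)
    rw [hγ.of_le ⟨le_rfl, hAB⟩ ht₀ ht₀.1, dist_comm (γ A) x] at h2
    linarith
  obtain ⟨β, hβ1, hβ2, hβ3⟩ := exists_concat_left hX le_rfl le_rfl hγ.isQIEmbeddingOn ht₀ hmin
  set d := dist x (γ t₀)
  have hd : 0 ≤ d := dist_nonneg
  have hd' : t₀ - d ≤ B := by linarith [ht₀.2]
  obtain ⟨t₁, ht₁', hmin'⟩ := exists_almost_nearest β y hd'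
  have h1 : B - t₁ ≤ 6 * D₂ + 9 := by
    have h1 := hmin' B ⟨hd', le_rfl⟩
    have h2 := (hβ3.of_le (by norm_num) ht₁' ⟨hd', le_rfl⟩ ht₁'.2).1
    rw [hβ2 B ht₀.2] at h1 h2
    have h3 := dist_triangle (β t₁) y (γ B)
    rw [dist_comm (β t₁) y] at h3
    linarith
  obtain ⟨β', hβ1', hβ2', hβ3'⟩ := exists_concat_right hX (by norm_num) (by norm_num) hβ3 ht₁' hmin'
  set d' := dist y (β t₁)
  have hd'0 : 0 ≤ d' := dist_nonneg
  -- Each of the two concatenations multiplies the first constant by 3 and adds 2 to the second, so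
  -- the geodesic has become part of a `(9, 4)`-quasi-geodesic. Hence the bound `g 9 4`, independent
  -- of `D₁` and `D₂`.
  norm_num at hβ3'
  have := hS 9 4 (t₀ - d) (t₁ + d') β' (by norm_num) (by norm_num) (by linarith [ht₁'.1]) hβ3'
    (by rw [hβ2' _ ht₁'.1, hβ1]; exact hx) (by rw [hβ1']; exact hy) t
    ⟨by linarith, by linarith⟩
  rwa [hβ2' t (by linarith), hβ2 t (by linarith)] at this

/-! ### Gauges -/

/-- A Morse gauge as a function of real variables. -/
noncomputable def realGauge (N : MorseGauge) (l e : ℝ) : ℝ := N (projIci 1 l) (projIci 0 e)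

/-- The Morse gauge given by a function of real variables. -/
noncomputable def gaugeOf (g : ℝ → ℝ → ℝ) : MorseGauge := fun l e => (g l e).toNNReal

theorem IsMorse.morseSet {ι : Type*} [Preorder ι] [TopologicalSpace ι] {N : MorseGauge}
    {γ : ι → X} (h : IsMorse N γ) {J : Set ι} (hJ : IsClosed J) (hJ' : J.OrdConnected) :
    MorseSet (realGauge N) (γ '' J) := by
  intro l e a b β hl he hab hβ ha hb t ht
  obtain ⟨s, hs, hd⟩ := h J hJ hJ' ⟨l, hl⟩ ⟨e, he⟩ a b β hab hβ ha hb t ht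
  refine ⟨γ s, mem_image_of_mem _ hs, hd.trans_eq ?_⟩
  simp [realGauge, projIci_of_mem (mem_Ici.2 hl), projIci_of_mem (mem_Ici.2 he)]

theorem isMorse_gaugeOf {ι : Type*} [Preorder ι] [TopologicalSpace ι] {g : ℝ → ℝ → ℝ}
    {γ : ι → X} (h : ∀ J : Set ι, IsClosed J → J.OrdConnected → MorseSet g (γ '' J)) :
    IsMorse (gaugeOf g) γ := by
  intro J hJ hJ' l e a b β hab hβ ha hb t ht
  obtain ⟨_, ⟨s, hs, rfl⟩, hd⟩ := h J hJ hJ' l e a b β l.2 e.2 hab hβ ha hb t ht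
  exact ⟨s, hs, hd.trans (Real.le_coe_toNNReal _)⟩

/-! ### Rays and lines -/

theorem FiniteHausdorff.symm {S T : Set X} (h : FiniteHausdorff S T) : FiniteHausdorff T S := by
  unfold FiniteHausdorff at *
  rwa [Metric.hausdorffEDist_comm]

theorem FiniteHausdorff.trans {S T U : Set X} (h₁ : FiniteHausdorff S T)
    (h₂ : FiniteHausdorff T U) : FiniteHausdorff S U :=
  ne_top_of_le_ne_top (ENNReal.add_ne_top.2 ⟨h₁, h₂⟩) Metric.hausdorffEDist_triangle

theorem FiniteHausdorff.exists_dist_le {S T : Set X} (h : FiniteHausdorff S T) :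
    ∃ D, ∀ x ∈ S, ∃ y ∈ T, dist x y ≤ D :=
  ⟨Metric.hausdorffDist S T + 1, fun _ hx =>
    (Metric.exists_dist_lt_of_hausdorffDist_lt hx (lt_add_one _) h).imp fun _ hy =>
      ⟨hy.1, hy.2.le⟩⟩

theorem finiteHausdorff_of_dist_le {S T : Set X} {D : ℝ} (h₁ : ∀ x ∈ S, ∃ y ∈ T, dist x y ≤ D)
    (h₂ : ∀ y ∈ T, ∃ x ∈ S, dist y x ≤ D) : FiniteHausdorff S T := by
  refine ne_top_of_le_ne_top (ENNReal.ofReal_ne_top (r := D)) (Metric.hausdorffEDist_le_of_mem_edist ?_ ?_)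
  · intro x hx
    obtain ⟨y, hy, hd⟩ := h₁ x hx
    exact ⟨y, hy, by rw [edist_dist]; exact ENNReal.ofReal_le_ofReal hd⟩
  · intro x hx
    obtain ⟨y, hy, hd⟩ := h₂ x hx
    exact ⟨y, hy, by rw [edist_dist]; exact ENNReal.ofReal_le_ofReal hd⟩

/-- `ρ`, restricted to `[0, ∞)`, is a geodesic ray in the class `a`. -/
def IsRayTo {p : X} (ρ : ℝ → X) (a : MorseBoundary p) : Prop :=
  IsGeodesicOn ρ (Ici 0) ∧ ∃ α : GeodesicRay p, Represents α a ∧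
    FiniteHausdorff (ρ '' Ici 0) (range α.toFun)

/-- `ρ`, restricted to `[0, ∞)`, is Morse. -/
def MorseRay (g : ℝ → ℝ → ℝ) (ρ : ℝ → X) : Prop :=
  ∀ J : Set ℝ, J ⊆ Ici 0 → IsClosed J → J.OrdConnected → MorseSet g (ρ '' J)

/-- If a ray starts close to another one and stays in some neighbourhood of it, then they are
close at equal times. -/
theorem dist_le_of_near_ray {ρ σ : ℝ → X} (hσ : IsGeodesicOn σ (Ici 0)) {D D₀ : ℝ}
    (h0 : dist (ρ 0) (σ 0) ≤ D₀) {t : ℝ} (ht : 0 ≤ t) (h1 : dist (ρ 0) (ρ t) = t - 0)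
    (h : ∃ s, 0 ≤ s ∧ dist (ρ t) (σ s) ≤ D) : dist (ρ t) (σ t) ≤ 2 * D + D₀ := by
  obtain ⟨s, hs, hd⟩ := h
  have h2 := hσ.of_le self_mem_Ici hs hs
  have h3 := hσ s hs t ht
  have h4 := dist_triangle (ρ t) (σ s) (σ t)
  have h5 := dist_triangle4 (ρ 0) (σ 0) (σ s) (ρ t)
  have h6 := dist_triangle4 (σ 0) (ρ 0) (ρ t) (σ s)
  rw [dist_comm (σ s) (ρ t)] at h5
  rw [dist_comm (σ 0) (ρ 0)] at h6
  have : dist s t ≤ D + D₀ := by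
    rw [Real.dist_eq, abs_le]
    constructor <;> linarith
  linarith

theorem represents_eq {α β : GeodesicRay p} {a b : MorseBoundary p} (hα : Represents α a)
    (hβ : Represents β b) : a = b ↔ FiniteHausdorff (range α.toFun) (range β.toFun) := by
  refine Subtype.ext_iff.trans ?_
  rw [← hα, ← hβ]
  exact Quotient.eq (r := asymptoticSetoid p)

theorem IsRayTo.exists_dist_le {ρ σ : ℝ → X} {a : MorseBoundary p} (hρ : IsRayTo ρ a)
    (hσ : IsRayTo σ a) : ∃ D, ∀ t, 0 ≤ t → dist (ρ t) (σ t) ≤ D := by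
  obtain ⟨hρ, α, hα, hρα⟩ := hρ
  obtain ⟨hσ, β, hβ, hσβ⟩ := hσ
  have : FiniteHausdorff (ρ '' Ici 0) (σ '' Ici 0) :=
    (hρα.trans ((represents_eq hα hβ).1 rfl)).trans hσβ.symm
  obtain ⟨D, hD⟩ := this.exists_dist_le
  refine ⟨2 * D + dist (ρ 0) (σ 0), fun t ht => dist_le_of_near_ray hσ le_rfl ht (hρ.of_le self_mem_Ici ht ht) ?_⟩
  obtain ⟨_, ⟨s, hs, rfl⟩, h⟩ := hD _ (mem_image_of_mem _ ht)
  exact ⟨s, hs, h⟩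

theorem finiteHausdorff_rays {ρ σ : ℝ → X} (hρ : IsGeodesicOn ρ (Ici 0))
    (hσ : IsGeodesicOn σ (Ici 0)) {D : ℝ} (h : ∀ t, 0 ≤ t → ∃ s, 0 ≤ s ∧ dist (ρ t) (σ s) ≤ D) :
    FiniteHausdorff (ρ '' Ici 0) (σ '' Ici 0) := by
  have key := fun t ht => dist_le_of_near_ray hσ le_rfl ht (hρ.of_le self_mem_Ici ht ht) (h t ht)
  refine finiteHausdorff_of_dist_le (D := 2 * D + dist (ρ 0) (σ 0)) ?_ ?_
  · rintro _ ⟨t, ht, rfl⟩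
    exact ⟨σ t, mem_image_of_mem _ ht, key t ht⟩
  · rintro _ ⟨t, ht, rfl⟩
    exact ⟨ρ t, mem_image_of_mem _ ht, by rw [dist_comm]; exact key t ht⟩

theorem IsRayTo.eq_of_near {ρ σ : ℝ → X} {a b : MorseBoundary p} (hρ : IsRayTo ρ a)
    (hσ : IsRayTo σ b) {D : ℝ} (h : ∀ t, 0 ≤ t → ∃ s, 0 ≤ s ∧ dist (ρ t) (σ s) ≤ D) : a = b := by
  have := finiteHausdorff_rays hρ.1 hσ.1 h
  obtain ⟨hρ, α, hα, hρα⟩ := hρ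
  obtain ⟨hσ, β, hβ, hσβ⟩ := hσ
  exact (represents_eq hα hβ).2 ((hρα.symm.trans this).trans hσβ)

theorem IsRayTo.of_near {ρ σ : ℝ → X} {a : MorseBoundary p} (hσ : IsRayTo σ a)
    (hρ : IsGeodesicOn ρ (Ici 0)) {D : ℝ} (h : ∀ t, 0 ≤ t → ∃ s, 0 ≤ s ∧ dist (ρ t) (σ s) ≤ D) :
    IsRayTo ρ a := by
  have := finiteHausdorff_rays hρ hσ.1 h
  obtain ⟨hσ, β, hβ, hσβ⟩ := hσ
  exact ⟨hρ, β, hβ, this.trans hσβ⟩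

theorem IsGeodesicOn.shift {ρ : ℝ → X} (h : IsGeodesicOn ρ (Ici 0)) {s : ℝ} (hs : 0 ≤ s) :
    IsGeodesicOn (fun t => ρ (s + t)) (Ici 0) := by
  intro t ht u hu
  rw [h _ (add_nonneg hs ht) _ (add_nonneg hs hu), dist_add_left]

theorem IsRayTo.shift {ρ : ℝ → X} {a : MorseBoundary p} (h : IsRayTo ρ a) {s : ℝ} (hs : 0 ≤ s) :
    IsRayTo (fun t => ρ (s + t)) a :=
  h.of_near (h.1.shift hs) (D := 0) fun t ht => ⟨s + t, add_nonneg hs ht, by simp⟩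

theorem MorseRay.mono {g g' : ℝ → ℝ → ℝ} {ρ : ℝ → X} (h : MorseRay g ρ)
    (hg : ∀ l e, 1 ≤ l → 0 ≤ e → g l e ≤ g' l e) : MorseRay g' ρ :=
  fun J h0 h1 h2 => (h J h0 h1 h2).mono hg

theorem MorseRay.morseSet {g : ℝ → ℝ → ℝ} {ρ : ℝ → X} (h : MorseRay g ρ) :
    MorseSet g (ρ '' Ici 0) :=
  h _ subset_rfl isClosed_Ici ordConnected_Ici

theorem image_comp_add_left {A : Type*} (f : ℝ → A) (s : ℝ) (J : Set ℝ) :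
    (fun t => f (s + t)) '' J = f '' ((fun t => -s + t) ⁻¹' J) := by
  rw [← image_add_left, image_image]

theorem MorseRay.shift {g : ℝ → ℝ → ℝ} {ρ : ℝ → X} (h : MorseRay g ρ) {s : ℝ} (hs : 0 ≤ s) :
    MorseRay g (fun t => ρ (s + t)) := by
  intro J hJ hJ1 hJ2
  rw [image_comp_add_left]
  refine h _ ?_ (hJ1.preimage (by fun_prop)) (hJ2.preimage_mono fun _ _ h => by simpa using h)
  intro t ht
  have : 0 ≤ -s + t := hJ ht
  exact mem_Ici.2 (by linarith)

theorem image_toNNReal_Ici {A : Type*} (f : ℝ≥0 → A) : (fun t : ℝ => f t.toNNReal) '' Ici 0 = range f := by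
  ext x
  constructor
  · rintro ⟨t, -, rfl⟩
    exact ⟨_, rfl⟩
  · rintro ⟨t, rfl⟩
    exact ⟨t, t.2, by simp⟩

theorem Represents.isRayTo {α : GeodesicRay p} {a : MorseBoundary p} (h : Represents α a) :
    IsRayTo (fun t => α.toFun t.toNNReal) a := by
  refine ⟨fun s hs t ht => ?_, α, h, ?_⟩
  · rw [α.isometry.dist_eq, NNReal.dist_eq, Real.coe_toNNReal _ hs, Real.coe_toNNReal _ ht,
      Real.dist_eq]
  · rw [image_toNNReal_Ici]
    exact finiteHausdorff_of_dist_le (D := 0) (fun x hx => ⟨x, hx, by simp⟩)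
      fun x hx => ⟨x, hx, by simp⟩

theorem MorseBoundary.exists_morseRay (a : MorseBoundary p) :
    ∃ (g : ℝ → ℝ → ℝ) (ρ : ℝ → X), ρ 0 = p ∧ IsRayTo ρ a ∧ MorseRay g ρ := by
  obtain ⟨N, α, hα, hN⟩ := a.2
  have hα' : Represents α a := hα
  refine ⟨realGauge N, _, ?_, hα'.isRayTo, ?_⟩
  · simp [α.map_zero]
  · intro J hJ hJ1 hJ2
    have h1 : (fun t : ℝ => α.toFun t.toNNReal) '' J = α.toFun '' ((fun t : ℝ≥0 => (t : ℝ)) ⁻¹' J) := by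
      ext x
      constructor
      · rintro ⟨t, ht, rfl⟩
        exact ⟨t.toNNReal, by simpa [Real.coe_toNNReal _ (hJ ht)] using ht, rfl⟩
      · rintro ⟨t, ht, rfl⟩
        exact ⟨t, ht, by simp⟩
    rw [h1]
    exact hN.morseSet (hJ1.preimage (by fun_prop)) (hJ2.preimage_mono fun _ _ h => h)

theorem IsLineFromTo.reverse {γ : ℝ → X} {a b : MorseBoundary p} (h : IsLineFromTo γ a b) :
    IsLineFromTo (fun t => γ (-t)) b a := by
  obtain ⟨h0, h1, h2⟩ := h
  refine ⟨h0.comp isometry_neg, ?_, ?_⟩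
  · have : (fun t : ℝ => γ (-t)) '' Iic 0 = γ '' Ici 0 := by
      rw [show (fun t => γ (-t)) = γ ∘ Neg.neg from rfl, image_comp]; simp
    rwa [this]
  · have : (fun t : ℝ => γ (-t)) '' Ici 0 = γ '' Iic 0 := by
      rw [show (fun t => γ (-t)) = γ ∘ Neg.neg from rfl, image_comp]; simp
    rwa [this]

theorem IsMorse.reverse {N : MorseGauge} {γ : ℝ → X} (h : IsMorse N γ) :
    IsMorse N (fun t : ℝ => γ (-t)) := by
  intro J hJ hJ' l e a b β hab hβ ha hb t ht
  have : (fun t : ℝ => γ (-t)) '' J = γ '' ((fun t : ℝ => -t) ⁻¹' J) := by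
    rw [show (fun t => γ (-t)) = γ ∘ Neg.neg from rfl, image_comp]; simp
  rw [this] at ha hb
  obtain ⟨s, hs, hd⟩ := h ((fun t : ℝ => -t) ⁻¹' J) (hJ.preimage continuous_neg)
    (hJ'.preimage_anti fun _ _ h => neg_le_neg h) l e a b β hab hβ ha hb t ht
  exact ⟨-s, hs, by simpa using hd⟩

theorem IsLineFromTo.isGeodesicOn {γ : ℝ → X} {a b : MorseBoundary p} (h : IsLineFromTo γ a b)
    (S : Set ℝ) : IsGeodesicOn γ S :=
  isGeodesicOn_of_isometry h.1 S

theorem isGeodesicOn_shift {γ : ℝ → X} (h : Isometry γ) (s : ℝ) (S : Set ℝ) :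
    IsGeodesicOn (fun t => γ (s + t)) S :=
  isGeodesicOn_of_isometry (h.comp (isometry_add_left s)) S

theorem IsLineFromTo.isRayTo_right {γ : ℝ → X} {a b : MorseBoundary p} (h : IsLineFromTo γ a b)
    (s : ℝ) : IsRayTo (fun t => γ (s + t)) b := by
  obtain ⟨α, hα, hd⟩ := h.2.2
  have h0 : IsRayTo γ b := ⟨h.isGeodesicOn _, α, hα, hd⟩
  refine h0.of_near (isGeodesicOn_shift h.1 s _) (D := |s|) fun t ht => ⟨t, ht, ?_⟩
  rw [h.1.dist_eq, Real.dist_eq]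
  simp

theorem IsLineFromTo.isRayTo_left {γ : ℝ → X} {a b : MorseBoundary p} (h : IsLineFromTo γ a b)
    (s : ℝ) : IsRayTo (fun t => γ (s - t)) a := by
  convert h.reverse.isRayTo_right (-s) using 3
  ring

theorem isLineFromTo_of_isRayTo {γ : ℝ → X} {a b : MorseBoundary p} (h : Isometry γ)
    (ha : IsRayTo (fun t => γ (-t)) a) (hb : IsRayTo γ b) : IsLineFromTo γ a b := by
  refine ⟨h, ?_, hb.2⟩
  have : (fun t : ℝ => γ (-t)) '' Ici 0 = γ '' Iic 0 := by
    rw [show (fun t => γ (-t)) = γ ∘ Neg.neg from rfl, image_comp]; simp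
  rw [← this]
  exact ha.2

theorem IsLineFromTo.ne {γ : ℝ → X} {a b : MorseBoundary p} (h : IsLineFromTo γ a b) : a ≠ b := by
  rintro rfl
  obtain ⟨D, hD⟩ := (h.isRayTo_left 0).exists_dist_le (h.isRayTo_right 0)
  have h1 := hD (|D| + 1) (by positivity)
  rw [h.1.dist_eq, Real.dist_eq] at h1
  have h2 : |0 - (|D| + 1) - (0 + (|D| + 1))| = 2 * |D| + 2 := by
    rw [abs_of_nonpos (by have := abs_nonneg D; linarith)]
    ring
  linarith [le_abs_self D, abs_nonneg D]

theorem IsMorse.morseSet_range {N : MorseGauge} {γ : ℝ → X} (h : IsMorse N γ) :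
    MorseSet (realGauge N) (range γ) := by
  rw [← image_univ]
  exact h.morseSet isClosed_univ ordConnected_univ

theorem IsMorse.morseRay_right {N : MorseGauge} {γ : ℝ → X} (h : IsMorse N γ) (s : ℝ) :
    MorseRay (realGauge N) (fun t => γ (s + t)) := by
  intro J hJ hJ1 hJ2
  rw [image_comp_add_left]
  exact h.morseSet (hJ1.preimage (by fun_prop)) (hJ2.preimage_mono fun _ _ h => by simpa using h)

theorem IsMorse.morseRay_left {N : MorseGauge} {γ : ℝ → X} (h : IsMorse N γ) (s : ℝ) :
    MorseRay (realGauge N) (fun t => γ (s - t)) := by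
  convert h.reverse.morseRay_right (-s) using 3
  ring

/-! ### Fellow travelling of rays and lines -/

/-- Around each point of a line there is room to choose endpoints far enough away, so the
unspecified `D` disappears from the conclusion. -/
theorem MorseSet.near_line (hX : IsGeodesicSpace X) {g : ℝ → ℝ → ℝ} {S : Set X}
    (hS : MorseSet g S) {γ : ℝ → X} (hγ : Isometry γ) {D : ℝ}
    (h : ∀ t, ∃ s ∈ S, dist s (γ t) ≤ D) (t : ℝ) : ∃ s ∈ S, dist (γ t) s ≤ g 9 4 :=
  hS.fellow_travel hX (isGeodesicOn_of_isometry hγ _) (h (t - 2 * D - 1)) (h (t + 6 * D + 9))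
    (by linarith) (by linarith)

theorem MorseSet.near_ray (hX : IsGeodesicSpace X) {g : ℝ → ℝ → ℝ} {S : Set X}
    (hS : MorseSet g S) {ρ : ℝ → X} (hρ : IsGeodesicOn ρ (Ici 0)) {D D₀ : ℝ}
    (h0 : ∃ s ∈ S, dist s (ρ 0) ≤ D₀) (h : ∀ t, 0 ≤ t → ∃ s ∈ S, dist s (ρ t) ≤ D) {t : ℝ}
    (ht : 0 ≤ t) : ∃ s ∈ S, dist (ρ t) s ≤ max (g 9 4) (3 * D₀ + 1) := by
  have hD : 0 ≤ D := by obtain ⟨s, -, hs⟩ := h 0 le_rfl; exact dist_nonneg.trans hs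
  rcases le_total (2 * D₀ + 1) t with h1 | h1
  · obtain ⟨s, hs, hd⟩ := hS.fellow_travel hX (A := 0) (B := t + 6 * D + 9)
      (hρ.mono fun x hx => hx.1) h0 (h _ (by linarith)) (t := t) (by linarith) (by linarith)
    exact ⟨s, hs, hd.trans (le_max_left _ _)⟩
  · obtain ⟨s, hs, hd⟩ := h0
    refine ⟨s, hs, le_trans ?_ (le_max_right _ _)⟩
    have h2 := dist_triangle (ρ t) (ρ 0) s
    rw [dist_comm (ρ t) (ρ 0), hρ.of_le self_mem_Ici ht ht, dist_comm (ρ 0) s] at h2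
    linarith

/-- Two asymptotic rays, one of which is Morse, come uniformly close to each other. -/
theorem MorseRay.exists_close (hX : IsGeodesicSpace X) {g : ℝ → ℝ → ℝ} {ρ σ : ℝ → X}
    {a : MorseBoundary p} (hσ : MorseRay g σ) (hσa : IsRayTo σ a) (hρ : IsRayTo ρ a) :
    ∃ t, 0 ≤ t ∧ ∃ s, 0 ≤ s ∧ dist (ρ t) (σ s) ≤ g 9 4 := by
  obtain ⟨D, hD⟩ := hρ.exists_dist_le hσa
  have hD0 : 0 ≤ D := dist_nonneg.trans (hD 0 le_rfl)
  have h : ∀ t, 0 ≤ t → ∃ s ∈ σ '' Ici 0, dist s (ρ t) ≤ D := fun t ht =>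
    ⟨σ t, mem_image_of_mem _ ht, by rw [dist_comm]; exact hD t ht⟩
  obtain ⟨_, ⟨s, hs, rfl⟩, hd⟩ := hσ.morseSet.fellow_travel hX (A := 0)
    (B := 2 * D + 1 + 6 * D + 9) (hρ.1.mono fun x hx => hx.1) (h _ le_rfl) (h _ (by linarith))
    (t := 2 * D + 1) (by linarith) (by linarith)
  exact ⟨2 * D + 1, by linarith, s, hs, hd⟩

/-! ### Lines between the endpoints of two Morse rays -/

theorem near_rays_of_line (hX : IsGeodesicSpace X) {g : ℝ → ℝ → ℝ} {K : ℝ} {ρ₁ ρ₂ γ : ℝ → X}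
    {a b : MorseBoundary p} (hρ₁ : IsRayTo ρ₁ a) (hρ₂ : IsRayTo ρ₂ b) (hm₁ : MorseRay g ρ₁)
    (hm₂ : MorseRay g ρ₂) (hK : dist (ρ₁ 0) (ρ₂ 0) ≤ K) (hγ : IsLineFromTo γ a b) (t : ℝ) :
    (∃ s, 0 ≤ s ∧ dist (γ t) (ρ₁ s) ≤ unionGauge g K 9 4) ∨
      ∃ s, 0 ≤ s ∧ dist (γ t) (ρ₂ s) ≤ unionGauge g K 9 4 := by
  have hS := hm₁.morseSet.union hX hm₂.morseSet (mem_image_of_mem ρ₁ (self_mem_Ici (a := (0 : ℝ))))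
    (mem_image_of_mem ρ₂ (self_mem_Ici (a := (0 : ℝ)))) hK
  obtain ⟨D₁, hD₁⟩ := (hγ.isRayTo_left 0).exists_dist_le hρ₁
  obtain ⟨D₂, hD₂⟩ := (hγ.isRayTo_right 0).exists_dist_le hρ₂
  obtain ⟨_, hs | hs, hd⟩ := hS.near_line hX hγ.1 (D := max D₁ D₂) (fun t => by
    rcases le_total 0 t with ht | ht
    · refine ⟨ρ₂ t, Or.inr (mem_image_of_mem _ ht), ?_⟩
      have := hD₂ t ht
      rw [zero_add, dist_comm] at this
      exact this.trans (le_max_right _ _)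
    · refine ⟨ρ₁ (-t), Or.inl (mem_image_of_mem _ (neg_nonneg.2 ht)), ?_⟩
      have := hD₁ (-t) (neg_nonneg.2 ht)
      rw [zero_sub, neg_neg, dist_comm] at this
      exact this.trans (le_max_left _ _)) t
  · obtain ⟨s, hs, rfl⟩ := hs
    exact Or.inl ⟨s, hs, hd⟩
  · obtain ⟨s, hs, rfl⟩ := hs
    exact Or.inr ⟨s, hs, hd⟩

theorem exists_near_both_rays (hX : IsGeodesicSpace X) {g : ℝ → ℝ → ℝ} {K : ℝ} {ρ₁ ρ₂ γ : ℝ → X}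
    {a b : MorseBoundary p} (hρ₁ : IsRayTo ρ₁ a) (hρ₂ : IsRayTo ρ₂ b) (hm₁ : MorseRay g ρ₁)
    (hm₂ : MorseRay g ρ₂) (hK : dist (ρ₁ 0) (ρ₂ 0) ≤ K) (hγ : IsLineFromTo γ a b) :
    ∃ q w₁ w₂, 0 ≤ w₁ ∧ 0 ≤ w₂ ∧ dist (γ q) (ρ₁ w₁) ≤ unionGauge g K 9 4 + 1 ∧
      dist (γ q) (ρ₂ w₂) ≤ unionGauge g K 9 4 + 1 := by
  have key := near_rays_of_line hX hρ₁ hρ₂ hm₁ hm₂ hK hγ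
  set δ := unionGauge g K 9 4
  -- If the half of `γ` towards `b` stayed near `ρ₁`, or the half towards `a` stayed near `ρ₂`, then
  -- `a = b`. So `γ` is near `ρ₁` at some `A ≤ 0` and not at some `B ≥ 0`, and `q` is found where
  -- this changes.
  have hB : ∃ B, 0 ≤ B ∧ ¬ ∃ s, 0 ≤ s ∧ dist (γ B) (ρ₁ s) ≤ δ := by
    by_contra! h
    refine hγ.ne ((hγ.isRayTo_right 0).eq_of_near hρ₁ (D := δ) fun t ht => ?_).symm
    simpa using h t ht
  have hA : ∃ A, A ≤ 0 ∧ ∃ s, 0 ≤ s ∧ dist (γ A) (ρ₁ s) ≤ δ := by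
    by_contra! h
    refine hγ.ne ((hγ.isRayTo_left 0).eq_of_near hρ₂ (D := δ) fun t ht => ?_)
    rw [zero_sub]
    refine (key (-t)).resolve_left ?_
    rintro ⟨s, hs, hd⟩
    exact absurd hd (not_le.2 (h (-t) (by linarith) s hs))
  obtain ⟨A, hA0, hA⟩ := hA
  obtain ⟨B, hB0, hB⟩ := hB
  obtain ⟨s, -, t, -, hst, hts, ⟨w₁, hw₁, h₁⟩, hnt⟩ :=
    exists_change (P := fun t => ∃ s, 0 ≤ s ∧ dist (γ t) (ρ₁ s) ≤ δ) (hA0.trans hB0) hA hB one_pos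
  obtain ⟨w₂, hw₂, h₂⟩ := (key t).resolve_left hnt
  refine ⟨t, w₁, w₂, hw₁, hw₂, ?_, by linarith⟩
  have h3 := dist_triangle (γ t) (γ s) (ρ₁ w₁)
  rw [hγ.1.dist_eq, Real.dist_eq, abs_of_nonneg (sub_nonneg.2 hst)] at h3
  linarith

/-- A bound for the distance of a line from the tails of two rays to its endpoints. -/
noncomputable def tailConst (g : ℝ → ℝ → ℝ) (K : ℝ) : ℝ :=
  2 * max (g 9 4) (3 * (unionGauge g K 9 4 + 1) + 1) + (unionGauge g K 9 4 + 1)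

/-- The bound involves only the distance of the starting points; the unspecified distance between
asymptotic rays is removed by `MorseSet.near_ray`. -/
theorem dist_tail_le (hX : IsGeodesicSpace X) {g : ℝ → ℝ → ℝ} {D₀ : ℝ} {ρ σ : ℝ → X}
    {a : MorseBoundary p} (hρ : IsRayTo ρ a) (hσ : IsRayTo σ a) (hm : MorseRay g σ)
    (h0 : dist (ρ 0) (σ 0) ≤ D₀) {t : ℝ} (ht : 0 ≤ t) :
    dist (ρ t) (σ t) ≤ 2 * max (g 9 4) (3 * D₀ + 1) + D₀ := by
  obtain ⟨D, hD⟩ := hρ.exists_dist_le hσ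
  refine dist_le_of_near_ray hσ.1 h0 ht (hρ.1.of_le self_mem_Ici ht ht) ?_
  obtain ⟨_, ⟨s, hs, rfl⟩, hd⟩ := hm.morseSet.near_ray hX hρ.1 (D := D) (D₀ := D₀)
    ⟨σ 0, mem_image_of_mem _ self_mem_Ici, by rwa [dist_comm]⟩
    (fun t ht => ⟨σ t, mem_image_of_mem _ ht, by rw [dist_comm]; exact hD t ht⟩) ht
  exact ⟨s, hs, hd⟩

theorem exists_tails (hX : IsGeodesicSpace X) {g : ℝ → ℝ → ℝ} {K : ℝ} {ρ₁ ρ₂ γ : ℝ → X}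
    {a b : MorseBoundary p} (hρ₁ : IsRayTo ρ₁ a) (hρ₂ : IsRayTo ρ₂ b) (hm₁ : MorseRay g ρ₁)
    (hm₂ : MorseRay g ρ₂) (hK : dist (ρ₁ 0) (ρ₂ 0) ≤ K) (hγ : IsLineFromTo γ a b) :
    ∃ q w₁ w₂, 0 ≤ w₁ ∧ 0 ≤ w₂ ∧
      (∀ t, 0 ≤ t → dist (γ (q - t)) (ρ₁ (w₁ + t)) ≤ tailConst g K) ∧
      ∀ t, 0 ≤ t → dist (γ (q + t)) (ρ₂ (w₂ + t)) ≤ tailConst g K := by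
  obtain ⟨q, w₁, w₂, hw₁, hw₂, h₁, h₂⟩ := exists_near_both_rays hX hρ₁ hρ₂ hm₁ hm₂ hK hγ
  refine ⟨q, w₁, w₂, hw₁, hw₂, fun t ht => ?_, fun t ht => ?_⟩
  · exact dist_tail_le hX (hγ.isRayTo_left q) (hρ₁.shift hw₁) (hm₁.shift hw₁) (by simpa using h₁) ht
  · exact dist_tail_le hX (hγ.isRayTo_right q) (hρ₂.shift hw₂) (hm₂.shift hw₂) (by simpa using h₂) ht

/-- A gauge for all lines between the endpoints of two Morse rays that start at distance at
most `K`. -/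
noncomputable def lineGauge (g : ℝ → ℝ → ℝ) (K : ℝ) : MorseGauge :=
  gaugeOf fun l e => max (unionGauge g (tailConst g K + tailConst g K) l
    (e + 2 * tailConst g K)) (tailConst g K) + tailConst g K

/-- Split the line at a point near both rays; each half runs parallel to a tail of one ray. A
subinterval of the line is then uniformly close to a union of pieces of the two tails, which is a
Morse set. -/
theorem isMorse_of_rays (hX : IsGeodesicSpace X) {g : ℝ → ℝ → ℝ} {K : ℝ} {ρ₁ ρ₂ γ : ℝ → X}
    {a b : MorseBoundary p} (hρ₁ : IsRayTo ρ₁ a) (hρ₂ : IsRayTo ρ₂ b) (hm₁ : MorseRay g ρ₁)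
    (hm₂ : MorseRay g ρ₂) (hK : dist (ρ₁ 0) (ρ₂ 0) ≤ K) (hγ : IsLineFromTo γ a b) :
    IsMorse (lineGauge g K) γ := by
  obtain ⟨q, w₁, w₂, hw₁, hw₂, h₁, h₂⟩ := exists_tails hX hρ₁ hρ₂ hm₁ hm₂ hK hγ
  set C := tailConst g K with hC
  have hC0 : 0 ≤ C := dist_nonneg.trans (h₁ 0 le_rfl)
  have h00 : dist (ρ₁ (w₁ + 0)) (ρ₂ (w₂ + 0)) ≤ C + C := by
    have h3 := h₁ 0 le_rfl
    have h4 := h₂ 0 le_rfl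
    rw [dist_comm] at h3
    rw [sub_zero] at h3
    rw [add_zero q] at h4
    exact (dist_triangle _ (γ q) _).trans (add_le_add h3 h4)
  refine isMorse_gaugeOf fun J hJ hJ' => ?_
  set J₁ : Set ℝ := Ici 0 ∩ (fun t => q - t) ⁻¹' J with hJ₁
  set J₂ : Set ℝ := Ici 0 ∩ (fun t => q + t) ⁻¹' J with hJ₂
  have hM₁ : MorseSet g ((fun t => ρ₁ (w₁ + t)) '' J₁) :=
    hm₁.shift hw₁ _ inter_subset_left (isClosed_Ici.inter (hJ.preimage (by fun_prop)))
      (ordConnected_Ici.inter (hJ'.preimage_anti fun _ _ h => sub_le_sub_left h q))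
  have hM₂ : MorseSet g ((fun t => ρ₂ (w₂ + t)) '' J₂) :=
    hm₂.shift hw₂ _ inter_subset_left (isClosed_Ici.inter (hJ.preimage (by fun_prop)))
      (ordConnected_Ici.inter (hJ'.preimage_mono fun _ _ h => by simpa using h))
  have hM : MorseSet (unionGauge g (C + C))
      ((fun t => ρ₁ (w₁ + t)) '' J₁ ∪ (fun t => ρ₂ (w₂ + t)) '' J₂) := by
    rcases J₁.eq_empty_or_nonempty with he₁ | ⟨t₁, ht₁, hq₁⟩
    · rw [he₁, image_empty, empty_union]
      exact hM₂.mono fun _ _ _ _ => le_max_left _ _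
    rcases J₂.eq_empty_or_nonempty with he₂ | ⟨t₂, ht₂, hq₂⟩
    · rw [he₂, image_empty, union_empty]
      exact hM₁.mono fun _ _ _ _ => le_max_left _ _
    rw [mem_Ici] at ht₁ ht₂
    -- As `J` meets both sides of `q`, it contains `q`. So both pieces contain the starting points
    -- of their tails, and these are close to `γ q`; this is the contact needed for the union.
    have hq : q ∈ J := hJ'.out hq₁ hq₂ ⟨by linarith, by linarith⟩
    exact hM₁.union hX hM₂ (mem_image_of_mem _ ⟨self_mem_Ici, by simpa using hq⟩)
      (mem_image_of_mem _ ⟨self_mem_Ici, by simpa using hq⟩) h00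
  refine hM.of_hausdorff hC0 ?_ ?_
  · rintro _ (⟨t, ⟨ht, htJ⟩, rfl⟩ | ⟨t, ⟨ht, htJ⟩, rfl⟩)
    · exact ⟨_, mem_image_of_mem _ htJ, by rw [dist_comm]; exact h₁ t ht⟩
    · exact ⟨_, mem_image_of_mem _ htJ, by rw [dist_comm]; exact h₂ t ht⟩
  · rintro _ ⟨t, ht, rfl⟩
    rcases le_total t q with htq | htq
    · refine ⟨_, Or.inl ⟨q - t, ⟨sub_nonneg.2 htq, by simpa using ht⟩, rfl⟩, ?_⟩
      simpa using h₁ (q - t) (sub_nonneg.2 htq)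
    · refine ⟨_, Or.inr ⟨t - q, ⟨sub_nonneg.2 htq, by simpa using ht⟩, rfl⟩, ?_⟩
      simpa using h₂ (t - q) (sub_nonneg.2 htq)

theorem exists_morseRay_pair (a b : MorseBoundary p) :
    ∃ (g : ℝ → ℝ → ℝ) (ρ₁ ρ₂ : ℝ → X), ρ₁ 0 = p ∧ ρ₂ 0 = p ∧ IsRayTo ρ₁ a ∧ IsRayTo ρ₂ b ∧
      MorseRay g ρ₁ ∧ MorseRay g ρ₂ := by
  obtain ⟨g₁, ρ₁, h1, h2, h3⟩ := a.exists_morseRay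
  obtain ⟨g₂, ρ₂, h4, h5, h6⟩ := b.exists_morseRay
  exact ⟨fun l e => max (g₁ l e) (g₂ l e), ρ₁, ρ₂, h1, h4, h2, h5,
    h3.mono fun _ _ _ _ => le_max_left _ _, h6.mono fun _ _ _ _ => le_max_right _ _⟩

theorem exists_isMorse_lines (hX : IsGeodesicSpace X) (a b : MorseBoundary p) :
    ∃ N : MorseGauge, ∀ γ : ℝ → X, IsLineFromTo γ a b → IsMorse N γ := by
  obtain ⟨g, ρ₁, ρ₂, h1, h2, h3, h4, h5, h6⟩ := exists_morseRay_pair a b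
  exact ⟨lineGauge g 0, fun γ hγ => isMorse_of_rays hX h3 h4 h5 h6 (by simp [h1, h2]) hγ⟩

/-! ### Existence of lines -/

/-- If `ρ₂` came within `D` of `ρ₁` at arbitrarily late times, fellow travelling would keep all of
`ρ₂` uniformly close to `ρ₁`. -/
theorem exists_bound_of_ne (hX : IsGeodesicSpace X) {g : ℝ → ℝ → ℝ} {ρ₁ ρ₂ : ℝ → X}
    {a b : MorseBoundary p} (h1 : ρ₁ 0 = p) (h2 : ρ₂ 0 = p) (hρ₁ : IsRayTo ρ₁ a)
    (hρ₂ : IsRayTo ρ₂ b) (hm₁ : MorseRay g ρ₁) (hab : a ≠ b) (D : ℝ) :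
    ∃ R, ∀ u v, 0 ≤ u → 0 ≤ v → dist (ρ₁ u) (ρ₂ v) ≤ D → v ≤ R := by
  by_contra! h
  refine hab (hρ₂.eq_of_near hρ₁ (D := max (g 9 4) 1) fun t ht => ?_).symm
  rcases le_total 1 t with ht1 | ht1
  · obtain ⟨u, v, hu, hv, hd, hR⟩ := h (t + 6 * D + 9)
    obtain ⟨_, ⟨s, hs, rfl⟩, hd⟩ := hm₁.morseSet.fellow_travel hX (A := 0) (B := v) (γ := ρ₂)
      (D₁ := 0) (D₂ := D) (hρ₂.1.mono fun x hx => hx.1)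
      ⟨ρ₁ 0, mem_image_of_mem _ self_mem_Ici, by simp [h1, h2]⟩ ⟨ρ₁ u, mem_image_of_mem _ hu, hd⟩
      (t := t) (by linarith) (by linarith)
    exact ⟨s, hs, hd.trans (le_max_left _ _)⟩
  · refine ⟨0, le_rfl, le_trans ?_ (le_max_right _ _)⟩
    rw [h1, ← h2, dist_comm, hρ₂.1.of_le self_mem_Ici ht ht]
    linarith

/-- A geodesic from `ρ₁ n` to `ρ₂ n` must switch from one ray to the other, and the two rays are
close only near `p`. Parametrised from the switching point, its halves follow the rays with
constants independent of `n`, ready for a limit. -/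
theorem exists_long_geodesics (hX : IsGeodesicSpace X) {g : ℝ → ℝ → ℝ} {ρ₁ ρ₂ : ℝ → X}
    {a b : MorseBoundary p} (h1 : ρ₁ 0 = p) (h2 : ρ₂ 0 = p) (hρ₁ : IsRayTo ρ₁ a)
    (hρ₂ : IsRayTo ρ₂ b) (hm₁ : MorseRay g ρ₁) (hm₂ : MorseRay g ρ₂) (hab : a ≠ b) :
    ∃ R C : ℝ, ∀ n : ℕ, ∃ τ : ℝ → X, dist p (τ 0) ≤ R ∧
      IsGeodesicOn τ (Icc (R - n) (n - R)) ∧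
      ∀ t ∈ Icc 0 (n - R), dist (τ (-t)) (ρ₁ t) ≤ C ∧ dist (τ t) (ρ₂ t) ≤ C := by
  have hS := hm₁.morseSet.union hX hm₂.morseSet (mem_image_of_mem ρ₁ (self_mem_Ici (a := (0 : ℝ))))
    (mem_image_of_mem ρ₂ (self_mem_Ici (a := (0 : ℝ)))) (D := 0) (by simp [h1, h2])
  set δ := unionGauge g 0 1 0 with hδ
  obtain ⟨R₀, hR₀⟩ := exists_bound_of_ne hX h1 h2 hρ₁ hρ₂ hm₁ hab ((δ + 1) + (δ + 1))
  set R := R₀ + (δ + 1) with hR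
  have hray : ∀ {σ ρ : ℝ → X} {c : MorseBoundary p} {n B : ℝ}, 0 ≤ n → 0 ≤ R → 0 ≤ B → ρ 0 = p →
      IsRayTo ρ c → MorseRay g ρ → IsGeodesicOn σ (Icc 0 B) → σ B = ρ n → dist p (σ 0) ≤ R →
      ∀ t ∈ Icc 0 B, dist (σ t) (ρ t) ≤ 2 * max (g 1 (0 + 2 * R)) R + R := by
    intro σ ρ c n B hn hR0 hB hρ0 hρ hm hσ hσB hσ0 t ht
    refine dist_le_of_near_ray hρ.1 (by rwa [hρ0, dist_comm]) ht.1
      (hσ.of_le ⟨le_rfl, hB⟩ ht ht.1) ?_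
    obtain ⟨_, ⟨s, hs, rfl⟩, hd⟩ := hm.morseSet.near hR0 le_rfl le_rfl hσ.isQIEmbeddingOn
      ⟨ρ 0, mem_image_of_mem _ self_mem_Ici, by rwa [hρ0, dist_comm]⟩
      ⟨ρ n, mem_image_of_mem _ hn, by simpa [hσB] using hR0⟩ ht
    exact ⟨s, hs, hd⟩
  refine ⟨R, 2 * max (g 1 (0 + 2 * R)) R + R, fun n => ?_⟩
  have hn : (0 : ℝ) ≤ n := n.cast_nonneg
  obtain ⟨σ, h0, hL, hσ⟩ := hX (ρ₁ n) (ρ₂ n)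
  set L := dist (ρ₁ n) (ρ₂ n) with hLdef
  have hL0 : 0 ≤ L := dist_nonneg
  have hσ : IsGeodesicOn σ (Icc 0 L) := hσ
  have key : ∀ t ∈ Icc 0 L, (∃ s, 0 ≤ s ∧ dist (σ t) (ρ₁ s) ≤ δ) ∨
      ∃ s, 0 ≤ s ∧ dist (σ t) (ρ₂ s) ≤ δ := by
    intro t ht
    obtain ⟨_, ⟨s, hs, rfl⟩ | ⟨s, hs, rfl⟩, hd⟩ := hS 1 0 0 L σ le_rfl le_rfl hL0 hσ.isQIEmbeddingOn
      (Or.inl ⟨n, hn, h0.symm⟩) (Or.inr ⟨n, hn, hL.symm⟩) t ht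
    · exact Or.inl ⟨s, hs, hd⟩
    · exact Or.inr ⟨s, hs, hd⟩
  have hδ0 : 0 ≤ δ := by
    rcases key 0 ⟨le_rfl, hL0⟩ with ⟨s, -, hd⟩ | ⟨s, -, hd⟩ <;> exact dist_nonneg.trans hd
  have hcross : ∃ q ∈ Icc 0 L, ∃ u v, 0 ≤ u ∧ 0 ≤ v ∧ dist (σ q) (ρ₁ u) ≤ δ + 1 ∧
      dist (σ q) (ρ₂ v) ≤ δ + 1 := by
    by_cases hPL : ∃ s, 0 ≤ s ∧ dist (σ L) (ρ₁ s) ≤ δ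
    · obtain ⟨u, hu, hd⟩ := hPL
      exact ⟨L, ⟨hL0, le_rfl⟩, u, n, hu, hn, by linarith, by rw [hL, dist_self]; linarith⟩
    · obtain ⟨s, hs, t, ht, hst, hts, ⟨u, hu, hdu⟩, hnt⟩ :=
        exists_change (P := fun t => ∃ s, 0 ≤ s ∧ dist (σ t) (ρ₁ s) ≤ δ) hL0
          ⟨n, hn, by simpa [h0] using hδ0⟩ hPL one_pos
      obtain ⟨v, hv, hdv⟩ := (key t ht).resolve_left hnt
      refine ⟨t, ht, u, v, hu, hv, ?_, by linarith⟩
      have h3 := dist_triangle (σ t) (σ s) (ρ₁ u)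
      rw [dist_comm (σ t) (σ s), hσ.of_le hs ht hst] at h3
      linarith
  obtain ⟨q, hq, u, v, hu, hv, hqu, hqv⟩ := hcross
  have hvR : v ≤ R₀ := by
    refine hR₀ u v hu hv ((dist_triangle _ (σ q) _).trans (add_le_add ?_ hqv))
    rwa [dist_comm]
  have hpq : dist p (σ q) ≤ R := by
    have h3 := dist_triangle p (ρ₂ v) (σ q)
    rw [dist_comm (ρ₂ v)] at h3
    have h4 := hρ₂.1.of_le self_mem_Ici hv hv
    rw [h2] at h4
    linarith
  have hR0 : 0 ≤ R := dist_nonneg.trans hpq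
  have hqn : n - R ≤ q := by
    have h3 := dist_triangle p (σ q) (ρ₁ n)
    have h4 := hρ₁.1.of_le self_mem_Ici hn hn
    rw [h1] at h4
    have h5 := hσ.of_le ⟨le_rfl, hL0⟩ hq hq.1
    rw [h0, dist_comm] at h5
    linarith
  have hLq : n - R ≤ L - q := by
    have h3 := dist_triangle p (σ q) (ρ₂ n)
    have h4 := hρ₂.1.of_le self_mem_Ici hn hn
    rw [h2] at h4
    have h5 := hσ.of_le hq ⟨hL0, le_rfl⟩ hq.2
    rw [hL] at h5
    linarith
  refine ⟨fun t => σ (q + t), by simpa using hpq, ?_, fun t ht => ⟨?_, ?_⟩⟩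
  · intro s hs t ht
    rw [hσ _ ⟨by linarith [hs.1], by linarith [hs.2]⟩ _ ⟨by linarith [ht.1], by linarith [ht.2]⟩,
      dist_add_left]
  · refine hray (σ := fun t => σ (q + -t)) (B := q) hn hR0 hq.1 h1 hρ₁ hm₁ ?_ (by simp [h0])
      (by simpa using hpq) t ⟨ht.1, by linarith [ht.2]⟩
    intro s hs t ht
    rw [hσ _ ⟨by linarith [hs.2], by linarith [hs.1, hq.2]⟩ _
      ⟨by linarith [ht.2], by linarith [ht.1, hq.2]⟩, dist_add_left, dist_neg_neg]
  · refine hray (σ := fun t => σ (q + t)) (B := L - q) hn hR0 (sub_nonneg.2 hq.2) h2 hρ₂ hm₂ ?_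
      (by simp [hL]) (by simpa using hpq) t ⟨ht.1, by linarith [ht.2]⟩
    intro s hs t ht
    rw [hσ _ ⟨by linarith [hs.1, hq.1], by linarith [hs.2]⟩ _
      ⟨by linarith [ht.1, hq.1], by linarith [ht.2]⟩, dist_add_left]

/-- Distinct points of the Morse boundary are joined by a bi-infinite geodesic. -/
theorem exists_isLineFromTo [ProperSpace X] (hX : IsGeodesicSpace X) {a b : MorseBoundary p}
    (hab : a ≠ b) : ∃ γ : ℝ → X, IsLineFromTo γ a b := by
  obtain ⟨g, ρ₁, ρ₂, h1, h2, hρ₁, hρ₂, hm₁, hm₂⟩ := exists_morseRay_pair a b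
  obtain ⟨R, C, h⟩ := exists_long_geodesics hX h1 h2 hρ₁ hρ₂ hm₁ hm₂ hab
  choose τ hτ0 hτ hτρ using h
  -- Limits are taken along an ultrafilter, so that all parameters `t` converge at once without a
  -- diagonal argument.
  have hlarge : ∀ t : ℝ, ∀ᶠ n : ℕ in (hyperfilter ℕ : Filter ℕ), |t| ≤ n - R := by
    intro t
    have : ∀ᶠ n : ℕ in atTop, |t| ≤ n - R := by
      filter_upwards [eventually_ge_atTop ⌈|t| + R⌉₊] with n hn
      linarith [Nat.ceil_le.1 hn]
    exact Nat.hyperfilter_le_atTop this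
  have hmem : ∀ {t : ℝ} {n : ℕ}, |t| ≤ n - R → t ∈ Icc (R - n) (n - R) := by
    intro t n ht
    obtain ⟨h3, h4⟩ := abs_le.1 ht
    exact ⟨by linarith, h4⟩
  have hlim : ∀ t : ℝ, ∃ y, Tendsto (fun n => τ n t) (hyperfilter ℕ) (𝓝 y) := by
    intro t
    obtain ⟨y, -, hy⟩ := (isCompact_closedBall p (R + |t|)).ultrafilter_le_nhds'
      ((hyperfilter ℕ).map fun n => τ n t) (by
        rw [Ultrafilter.mem_map]
        filter_upwards [hlarge t] with n hn
        have h3 := dist_triangle p (τ n 0) (τ n t)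
        rw [hτ n 0 (hmem (by simpa using (abs_nonneg t).trans hn)) t (hmem hn), dist_comm (0 : ℝ),
          Real.dist_0_eq_abs] at h3
        rw [mem_preimage, Metric.mem_closedBall, dist_comm]
        linarith [hτ0 n])
    exact ⟨y, hy⟩
  choose γ hγ using hlim
  have hiso : Isometry γ := by
    refine Isometry.of_dist_eq fun s t => ?_
    refine tendsto_nhds_unique ((hγ s).dist (hγ t)) (tendsto_const_nhds.congr' ?_)
    filter_upwards [hlarge s, hlarge t] with n hs ht
    exact (hτ n s (hmem hs) t (hmem ht)).symm
  refine ⟨γ, isLineFromTo_of_isRayTo hiso ?_ ?_⟩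
  · refine hρ₁.of_near (isGeodesicOn_of_isometry (hiso.comp isometry_neg) _) (D := C)
      fun t ht => ⟨t, ht, ?_⟩
    refine le_of_tendsto ((hγ (-t)).dist tendsto_const_nhds) ?_
    filter_upwards [hlarge t] with n hn
    exact (hτρ n t ⟨ht, (le_abs_self t).trans hn⟩).1
  · refine hρ₂.of_near (isGeodesicOn_of_isometry hiso _) (D := C) fun t ht => ⟨t, ht, ?_⟩
    refine le_of_tendsto ((hγ t).dist tendsto_const_nhds) ?_
    filter_upwards [hlarge t] with n hn
    exact (hτρ n t ⟨ht, (le_abs_self t).trans hn⟩).2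

/-! ### Points near lines -/

/-- `x` is within `K` of some line from `u` to `v`. -/
def NearLine (K : ℝ) (x : X) (u v : MorseBoundary p) : Prop :=
  ∃ γ : ℝ → X, IsLineFromTo γ u v ∧ ∃ s, dist x (γ s) ≤ K

/-- All lines from `u` to `v` are `N`-Morse. -/
def PairMorse (N : MorseGauge) (u v : MorseBoundary p) : Prop :=
  ∀ γ : ℝ → X, IsLineFromTo γ u v → IsMorse N γ

/-- Some Morse ray to `u` starts within `K` of `x`. -/
def Anchored (g : ℝ → ℝ → ℝ) (K : ℝ) (x : X) (u : MorseBoundary p) : Prop :=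
  ∃ ρ : ℝ → X, IsRayTo ρ u ∧ MorseRay g ρ ∧ dist x (ρ 0) ≤ K

theorem NearLine.symm {K : ℝ} {x : X} {u v : MorseBoundary p} (h : NearLine K x u v) :
    NearLine K x v u := by
  obtain ⟨γ, hγ, s, hs⟩ := h
  exact ⟨_, hγ.reverse, -s, by simpa using hs⟩

theorem NearLine.ne {K : ℝ} {x : X} {u v : MorseBoundary p} (h : NearLine K x u v) : u ≠ v := by
  obtain ⟨γ, hγ, -⟩ := h
  exact hγ.ne

theorem NearLine.mono {K K' : ℝ} {x : X} {u v : MorseBoundary p} (h : NearLine K x u v)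
    (hK : K ≤ K') : NearLine K' x u v := by
  obtain ⟨γ, hγ, s, hs⟩ := h
  exact ⟨γ, hγ, s, hs.trans hK⟩

theorem NearLine.move {K D : ℝ} {x y : X} {u v : MorseBoundary p} (h : NearLine K x u v)
    (hD : dist y x ≤ D) : NearLine (K + D) y u v := by
  obtain ⟨γ, hγ, s, hs⟩ := h
  exact ⟨γ, hγ, s, (dist_triangle _ x _).trans (by linarith)⟩

theorem PairMorse.symm {N : MorseGauge} {u v : MorseBoundary p} (h : PairMorse N u v) :
    PairMorse N v u := by
  intro γ hγ
  simpa using (h _ hγ.reverse).reverse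

theorem PairMorse.mono {N N' : MorseGauge} {u v : MorseBoundary p} (h : PairMorse N u v)
    (hN : N ≤ N') : PairMorse N' u v := by
  intro γ hγ J hJ hJ' l e a b β hab hβ ha hb t ht
  obtain ⟨s, hs, hd⟩ := h γ hγ J hJ hJ' l e a b β hab hβ ha hb t ht
  exact ⟨s, hs, hd.trans (NNReal.coe_le_coe.2 (hN l e))⟩

theorem NearLine.anchored {N : MorseGauge} {K : ℝ} {x : X} {u v : MorseBoundary p}
    (h : NearLine K x u v) (hN : PairMorse N u v) : Anchored (realGauge N) K x u := by
  obtain ⟨γ, hγ, s, hs⟩ := h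
  exact ⟨_, hγ.isRayTo_left s, (hN γ hγ).morseRay_left s, by simpa using hs⟩

theorem Anchored.mono {g g' : ℝ → ℝ → ℝ} {K K' : ℝ} {x : X} {u : MorseBoundary p}
    (h : Anchored g K x u) (hg : ∀ l e, g l e ≤ g' l e) (hK : K ≤ K') : Anchored g' K' x u := by
  obtain ⟨ρ, h1, h2, h3⟩ := h
  exact ⟨ρ, h1, h2.mono fun l e _ _ => hg l e, h3.trans hK⟩

/-- This is how Morseness passes to new pairs: the gauge depends only on `g` and `K`, not on `x`,
`u` or `v`. For `u = v` the conclusion is vacuous. -/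
theorem Anchored.pairMorse (hX : IsGeodesicSpace X) {g : ℝ → ℝ → ℝ} {K : ℝ} {x : X}
    {u v : MorseBoundary p} (hu : Anchored g K x u) (hv : Anchored g K x v) :
    PairMorse (lineGauge g (2 * K)) u v := by
  obtain ⟨ρ, h1, h2, h3⟩ := hu
  obtain ⟨σ, h4, h5, h6⟩ := hv
  refine fun γ hγ => isMorse_of_rays hX h1 h4 h2 h5 ?_ hγ
  have := dist_triangle_left (ρ 0) (σ 0) x
  linarith

theorem realGauge_nonneg (N : MorseGauge) (l e : ℝ) : 0 ≤ realGauge N l e := NNReal.coe_nonneg _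

/-- A slimness constant for ideal triangles with `N`-Morse sides. -/
noncomputable def slimConst (N : MorseGauge) : ℝ :=
  unionGauge (realGauge N) (realGauge N 9 4) 9 4

theorem slimConst_nonneg (N : MorseGauge) : 0 ≤ slimConst N :=
  (realGauge_nonneg N 9 4).trans (le_max_left _ _)

/-- Slimness of ideal triangles, with `w` allowed to coincide with `u` or `v`. The lines `u w` and
`w v` come close near `w`; cut there, they give two Morse rays with nearby starting points, and the
line `u v` lies near their union. -/
theorem NearLine.or [ProperSpace X] (hX : IsGeodesicSpace X) {N : MorseGauge} {K : ℝ} {x : X}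
    {u v : MorseBoundary p} (h : NearLine K x u v) (w : MorseBoundary p) (hu : PairMorse N u w)
    (hv : PairMorse N w v) :
    NearLine (K + slimConst N) x u w ∨ NearLine (K + slimConst N) x w v := by
  have hδ := slimConst_nonneg N
  rcases eq_or_ne u w with rfl | huw
  · exact Or.inr (h.mono (by linarith))
  rcases eq_or_ne w v with rfl | hwv
  · exact Or.inl (h.mono (by linarith))
  obtain ⟨γ₁, h₁⟩ := exists_isLineFromTo hX huw
  obtain ⟨γ₂, h₂⟩ := exists_isLineFromTo hX hwv
  obtain ⟨γ, hγ, q, hq⟩ := h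
  obtain ⟨t, -, s, -, hd⟩ := ((hv _ h₂).morseRay_left 0).exists_close hX (h₂.isRayTo_left 0)
    (h₁.isRayTo_right 0)
  rcases near_rays_of_line hX (h₁.isRayTo_left (0 + t)) (h₂.isRayTo_right (0 - s))
    ((hu _ h₁).morseRay_left _) ((hv _ h₂).morseRay_right _) (by simpa using hd) hγ q with
    ⟨w, -, hw⟩ | ⟨w, -, hw⟩
  · exact Or.inl ⟨γ₁, h₁, _, (dist_triangle _ _ _).trans (add_le_add hq hw)⟩
  · exact Or.inr ⟨γ₂, h₂, _, (dist_triangle _ _ _).trans (add_le_add hq hw)⟩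

theorem exists_isInternalConstant (hX : IsGeodesicSpace X) (p : X) (N : MorseGauge) :
    ∃ K, IsInternalConstant p N K := by
  have hδ := slimConst_nonneg N
  refine ⟨2 * (slimConst N + 1), by linarith, ?_⟩
  rintro a b c γab γbc γac ⟨hab, hbc, hac⟩ - mbc mac
  obtain ⟨t, -, s, -, hd⟩ := (mbc.morseRay_right 0).exists_close hX (hbc.isRayTo_right 0)
    (hac.isRayTo_right 0)
  obtain ⟨q, w₁, w₂, -, -, h₁, h₂⟩ := exists_near_both_rays hX (hac.isRayTo_left (0 + t))
    (hbc.isRayTo_left (0 + s)) (mac.morseRay_left _) (mbc.morseRay_left _) (by simpa using hd) hab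
  change _ ≤ slimConst N + 1 at h₁ h₂
  refine ⟨q, _, _, h₂.trans (by linarith), ?_, h₁.trans (by linarith)⟩
  have := dist_triangle_left (γbc (0 + s - w₂)) (γac (0 + t - w₁)) (γab q)
  linarith

theorem near_of_same_endpoints (hX : IsGeodesicSpace X) {N : MorseGauge} {γ γ' : ℝ → X}
    {u v : MorseBoundary p} (hγ : IsLineFromTo γ u v) (hN : IsMorse N γ)
    (hγ' : IsLineFromTo γ' u v) (t : ℝ) : ∃ s, dist (γ' t) (γ s) ≤ realGauge N 9 4 := by
  obtain ⟨D₁, hD₁⟩ := (hγ.isRayTo_left 0).exists_dist_le (hγ'.isRayTo_left 0)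
  obtain ⟨D₂, hD₂⟩ := (hγ.isRayTo_right 0).exists_dist_le (hγ'.isRayTo_right 0)
  obtain ⟨_, ⟨s, rfl⟩, hd⟩ := hN.morseSet_range.near_line hX hγ'.1 (D := max D₁ D₂) (fun t => by
    refine ⟨γ t, mem_range_self t, ?_⟩
    rcases le_total 0 t with ht | ht
    · simpa using (hD₂ t ht).trans (le_max_right D₁ _)
    · simpa using (hD₁ (-t) (neg_nonneg.2 ht)).trans (le_max_left _ D₂)) t
  exact ⟨s, hd⟩

theorem NearLine.near (hX : IsGeodesicSpace X) {N : MorseGauge} {K : ℝ} {x : X} {γ : ℝ → X}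
    {u v : MorseBoundary p} (h : NearLine K x u v) (hγ : IsLineFromTo γ u v) (hN : IsMorse N γ) :
    ∃ s, dist x (γ s) ≤ K + realGauge N 9 4 := by
  obtain ⟨γ', hγ', t, ht⟩ := h
  obtain ⟨s, hs⟩ := near_of_same_endpoints hX hγ hN hγ' t
  exact ⟨s, (dist_triangle _ _ _).trans (add_le_add ht hs)⟩

/-- A point `y` between `x` and both `u` and `v` is close to `x` if a line from `u` to `v` is. -/
theorem dist_le_of_between (hX : IsGeodesicSpace X) {g : ℝ → ℝ → ℝ} {K : ℝ} {x y : X}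
    {ρ₁ ρ₂ : ℝ → X} {u v : MorseBoundary p} (hρ₁ : IsRayTo ρ₁ u) (hρ₂ : IsRayTo ρ₂ v)
    (hm₁ : MorseRay g ρ₁) (hm₂ : MorseRay g ρ₂) (hx₁ : dist x (ρ₁ 0) ≤ K)
    (hx₂ : dist x (ρ₂ 0) ≤ K) (hy₁ : ∃ s, 0 ≤ s ∧ dist y (ρ₁ s) ≤ K)
    (hy₂ : ∃ s, 0 ≤ s ∧ dist y (ρ₂ s) ≤ K) (hx : NearLine K x u v) :
    dist x y ≤ 4 * K + unionGauge g (2 * K) 9 4 := by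
  obtain ⟨γ, hγ, q, hq⟩ := hx
  obtain ⟨s₁, hs₁, hy₁⟩ := hy₁
  obtain ⟨s₂, hs₂, hy₂⟩ := hy₂
  -- The line lies near the tails beyond `y`, so `x` is near some `ρ (s + t)`. But `x` is also near
  -- `ρ 0`, which forces `s` to be small, and `y` is near `ρ s`.
  have key : ∀ {ρ : ℝ → X} {w : MorseBoundary p} {s t : ℝ}, IsRayTo ρ w → 0 ≤ s → 0 ≤ t →
      dist x (ρ 0) ≤ K → dist y (ρ s) ≤ K → dist (γ q) (ρ (s + t)) ≤ unionGauge g (2 * K) 9 4 →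
      dist x y ≤ 4 * K + unionGauge g (2 * K) 9 4 := by
    intro ρ w s t hρ hs ht h1 h2 h3
    have h4 := hρ.1.of_le self_mem_Ici hs hs
    have h5 := hρ.1.of_le self_mem_Ici (mem_Ici.2 (add_nonneg hs ht)) (add_nonneg hs ht)
    have h6 := dist_triangle4 (ρ 0) x (γ q) (ρ (s + t))
    have h7 := dist_triangle4 x (ρ 0) (ρ s) y
    rw [dist_comm (ρ 0) x] at h6
    rw [dist_comm (ρ s) y] at h7
    linarith
  rcases near_rays_of_line hX (K := 2 * K) (hρ₁.shift hs₁) (hρ₂.shift hs₂) (hm₁.shift hs₁)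
    (hm₂.shift hs₂) (by
      have := dist_triangle_left (ρ₁ s₁) (ρ₂ s₂) y
      simp only [add_zero]
      linarith) hγ q with ⟨t, ht, hd⟩ | ⟨t, ht, hd⟩
  · exact key hρ₁ hs₁ ht hx₁ hy₁ hd
  · exact key hρ₂ hs₂ ht hx₂ hy₂ hd

/-! ### Centers -/

/-- The sides of an ideal triangle can be chosen independently, so being a center splits into one
condition for each pair of vertices. -/
theorem mem_centers {K : ℝ} {a b c : MorseBoundary p} {x : X} :
    x ∈ centers K a b c ↔ NearLine K x a b ∧ NearLine K x b c ∧ NearLine K x a c := by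
  constructor
  · rintro ⟨γ₁, γ₂, γ₃, ⟨h₁, h₂, h₃⟩, h₄, h₅, h₆⟩
    exact ⟨⟨γ₁, h₁, h₄⟩, ⟨γ₂, h₂, h₅⟩, ⟨γ₃, h₃, h₆⟩⟩
  · rintro ⟨⟨γ₁, h₁, h₄⟩, ⟨γ₂, h₂, h₅⟩, ⟨γ₃, h₃, h₆⟩⟩
    exact ⟨γ₁, γ₂, γ₃, ⟨h₁, h₂, h₃⟩, h₄, h₅, h₆⟩

theorem mem_centers_iff_forall {K : ℝ} {T : Fin 3 → MorseBoundary p} {x : X} :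
    x ∈ centers K (T 0) (T 1) (T 2) ↔ ∀ i j, i ≠ j → NearLine K x (T i) (T j) := by
  rw [mem_centers]
  constructor
  · rintro ⟨h01, h12, h02⟩ i j hij
    fin_cases i <;> fin_cases j <;> first | exact absurd rfl hij | assumption | skip
    exacts [h01.symm, h02.symm, h12.symm]
  · intro h
    exact ⟨h 0 1 (by decide), h 1 2 (by decide), h 0 2 (by decide)⟩

theorem centers_swap_left (K : ℝ) (a b c : MorseBoundary p) :
    centers K a b c = centers K b a c := by
  ext x
  simp only [mem_centers]
  exact ⟨fun ⟨h1, h2, h3⟩ => ⟨h1.symm, h3, h2⟩, fun ⟨h1, h2, h3⟩ => ⟨h1.symm, h3, h2⟩⟩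

theorem centers_swap_right (K : ℝ) (a b c : MorseBoundary p) :
    centers K a b c = centers K a c b := by
  ext x
  simp only [mem_centers]
  exact ⟨fun ⟨h1, h2, h3⟩ => ⟨h3, h2.symm, h1⟩, fun ⟨h1, h2, h3⟩ => ⟨h3, h2.symm, h1⟩⟩

theorem centers_mono {K K' : ℝ} (hK : K ≤ K') (a b c : MorseBoundary p) :
    centers K a b c ⊆ centers K' a b c := by
  intro x
  simp only [mem_centers]
  exact fun ⟨h1, h2, h3⟩ => ⟨h1.mono hK, h2.mono hK, h3.mono hK⟩

/-- A bound for the diameter of the set of `K`-centers. -/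
noncomputable def centersConst (N : MorseGauge) (K : ℝ) : ℝ :=
  4 * (K + realGauge N 9 4) + unionGauge (realGauge N) (2 * (K + realGauge N 9 4)) 9 4

/-- On each side, the direction from the point near `x` to the point near `y` singles out one
endpoint. Three sides single out at least two different vertices `u`, `v`, so `y` lies between `x`
and both of them, while a line from `u` to `v` passes near `x`. -/
theorem dist_le_of_mem_centers (hX : IsGeodesicSpace X) {N : MorseGauge} {K : ℝ}
    {a b c : MorseBoundary p} (hab : PairMorse N a b) (hbc : PairMorse N b c)
    (hac : PairMorse N a c) {x y : X} (hx : x ∈ centers K a b c) (hy : y ∈ centers K a b c) :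
    dist x y ≤ centersConst N K := by
  rw [mem_centers] at hx hy
  have hN := realGauge_nonneg N 9 4
  set g := realGauge N with hg
  set K₁ := K + g 9 4 with hK₁
  set P : MorseBoundary p → Prop := fun u => ∃ ρ : ℝ → X, IsRayTo ρ u ∧ MorseRay g ρ ∧
    dist x (ρ 0) ≤ K₁ ∧ ∃ s, 0 ≤ s ∧ dist y (ρ s) ≤ K₁ with hP
  have h₁ : ∀ {u v : MorseBoundary p}, PairMorse N u v → NearLine K x u v → NearLine K y u v →
      P u ∨ P v := by
    rintro u v hm ⟨γ, hγ, s, hs⟩ hy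
    obtain ⟨t, ht⟩ := hy.near hX hγ (hm γ hγ)
    have hs' : dist x (γ s) ≤ K₁ := by linarith
    rcases le_total s t with hst | hst
    · exact Or.inr ⟨_, hγ.isRayTo_right s, (hm γ hγ).morseRay_right s, by simpa using hs',
        t - s, sub_nonneg.2 hst, by simpa using ht⟩
    · exact Or.inl ⟨_, hγ.isRayTo_left s, (hm γ hγ).morseRay_left s, by simpa using hs',
        s - t, sub_nonneg.2 hst, by simpa using ht⟩
  have h₂ : ∀ {u v : MorseBoundary p}, NearLine K x u v → P u → P v →
      dist x y ≤ centersConst N K := by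
    rintro u v hx ⟨ρ, h1, h2, h3, h4⟩ ⟨σ, h5, h6, h7, h8⟩
    exact dist_le_of_between hX h1 h5 h2 h6 h3 h7 h4 h8 (hx.mono (by linarith))
  obtain ⟨x1, x2, x3⟩ := hx
  obtain ⟨y1, y2, y3⟩ := hy
  rcases h₁ hab x1 y1 with ha | hb
  · rcases h₁ hbc x2 y2 with hb | hc
    · exact h₂ x1 ha hb
    · exact h₂ x3 ha hc
  · rcases h₁ hac x3 y3 with ha | hc
    · exact h₂ x1 ha hb
    · exact h₂ x2 hb hc

theorem centers_nonempty [ProperSpace X] (hX : IsGeodesicSpace X) {N : MorseGauge} {K : ℝ}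
    (hK : IsInternalConstant p N K) {a b c : MorseBoundary p} (hab : a ≠ b) (hbc : b ≠ c)
    (hac : a ≠ c) (mab : PairMorse N a b) (mbc : PairMorse N b c) (mac : PairMorse N a c) :
    (centers K a b c).Nonempty := by
  obtain ⟨γ₁, h₁⟩ := exists_isLineFromTo hX hab
  obtain ⟨γ₂, h₂⟩ := exists_isLineFromTo hX hbc
  obtain ⟨γ₃, h₃⟩ := exists_isLineFromTo hX hac
  obtain ⟨s, t, u, hst, -, hsu⟩ := hK.2 a b c γ₁ γ₂ γ₃ ⟨h₁, h₂, h₃⟩ (mab _ h₁) (mbc _ h₂) (mac _ h₃)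
  exact ⟨γ₁ s, γ₁, γ₂, γ₃, ⟨h₁, h₂, h₃⟩, ⟨s, by simpa using hK.1.le⟩, ⟨t, hst⟩, ⟨u, hsu⟩⟩

/-! ### Tuples -/

theorem mem_morseTuples_iff {n : ℕ} {N : MorseGauge} {T : Fin n → MorseBoundary p} :
    T ∈ morseTuples p n N ↔ ∀ i j, i ≠ j → T i ≠ T j ∧ PairMorse N (T i) (T j) := by
  constructor
  · rintro ⟨h1, h2⟩ i j hij
    exact ⟨h1.ne hij, h2 i j hij⟩
  · intro h
    exact ⟨fun i j hij => by_contra fun hne => (h i j hne).1 hij, fun i j hij => (h i j hij).2⟩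

theorem pair_mem_morseTuples {N : MorseGauge} {a b : MorseBoundary p} (hab : a ≠ b)
    (h : PairMorse N a b) : ![a, b] ∈ morseTuples p 2 N := by
  rw [mem_morseTuples_iff]
  intro i j hij
  fin_cases i <;> fin_cases j <;> first | exact absurd rfl hij | skip
  exacts [⟨hab, h⟩, ⟨hab.symm, h.symm⟩]

theorem MapsTuples.pair {N N' : MorseGauge} {h : MorseBoundary p → MorseBoundary r}
    (hh : MapsTuples 2 N N' h) {a b : MorseBoundary p} (hab : a ≠ b) (hm : PairMorse N a b) :
    h a ≠ h b ∧ PairMorse N' (h a) (h b) :=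
  mem_morseTuples_iff.1 (hh _ (pair_mem_morseTuples hab hm)) 0 1 (by decide)

theorem MapsTuples.of_two {N N' : MorseGauge} {h : MorseBoundary p → MorseBoundary r}
    (hh : MapsTuples 2 N N' h) (n : ℕ) : MapsTuples n N N' h := by
  intro T hT
  rw [mem_morseTuples_iff] at hT ⊢
  exact fun i j hij => hh.pair (hT i j hij).1 (hT i j hij).2

theorem quadruple_mem_morseTuples {N : MorseGauge} {a b c d : MorseBoundary p}
    (hab : a ≠ b) (hac : a ≠ c) (had : a ≠ d) (hbc : b ≠ c) (hbd : b ≠ d) (hcd : c ≠ d)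
    (mab : PairMorse N a b) (mac : PairMorse N a c) (mad : PairMorse N a d)
    (mbc : PairMorse N b c) (mbd : PairMorse N b d) (mcd : PairMorse N c d) :
    ![a, b, c, d] ∈ morseTuples p 4 N := by
  rw [mem_morseTuples_iff]
  intro i j hij
  fin_cases i <;> fin_cases j <;> first | exact absurd rfl hij | skip
  exacts [⟨hab, mab⟩, ⟨hac, mac⟩, ⟨had, mad⟩, ⟨hab.symm, mab.symm⟩, ⟨hbc, mbc⟩, ⟨hbd, mbd⟩,
    ⟨hac.symm, mac.symm⟩, ⟨hbc.symm, mbc.symm⟩, ⟨hcd, mcd⟩, ⟨had.symm, mad.symm⟩,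
    ⟨hbd.symm, mbd.symm⟩, ⟨hcd.symm, mcd.symm⟩]

/-- A relation between two sets of three elements that fails at most once in each row and column
fails only along some bijection. -/
theorem exists_matching {E : Fin 3 → Fin 3 → Prop}
    (h₁ : ∀ i j k, i ≠ j → E i k ∨ E j k) (h₂ : ∀ i k l, k ≠ l → E i k ∨ E i l) :
    ∃ σ : Fin 3 → Fin 3, σ.Injective ∧ ∀ i j, i ≠ j → E i (σ j) := by
  classical
  have hf : ∀ i, ∃ k, (∃ l, ¬ E i l) → ¬ E i k := by
    intro i
    by_cases h : ∃ l, ¬ E i l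
    · obtain ⟨l, hl⟩ := h
      exact ⟨l, fun _ => hl⟩
    · exact ⟨0, fun h' => absurd h' h⟩
  choose f hf using hf
  -- By `h₁`, failures chosen in different rows lie in different columns, so this partial choice is
  -- injective and extends to a bijection. Any failure off the bijection would be a second one in
  -- its row.
  obtain ⟨g, hg⟩ := Set.MapsTo.exists_equiv_extend_of_card_eq (α := Fin 3)
    (t := (Finset.univ : Finset (Fin 3))) (by simp) (s := {i | ∃ l, ¬ E i l}) (f := f)
    (fun _ _ => by simp) (by
      intro i hi j hj hij
      by_contra hne
      rcases h₁ i j (f i) hne with h | h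
      · exact hf i hi h
      · rw [hij] at h
        exact hf j hj h)
  refine ⟨fun i => g i, Subtype.val_injective.comp g.injective, fun i j hij => ?_⟩
  by_contra hE
  have hi : ∃ l, ¬ E i l := ⟨_, hE⟩
  have h3 : (g i : Fin 3) ≠ g j := fun h => hij (g.injective (Subtype.ext h))
  rcases h₂ i _ _ h3 with h | h
  · rw [hg i hi] at h
    exact hf i hi h
  · exact hE h

/-! ### Centers of image triples -/

section Centers

variable [ProperSpace Y] {κX κY : MorseGauge → ℝ}
  {h : MorseBoundary p → MorseBoundary r}

/-- The cross-ratio of `(b, a, c, d)` compares the centers of `(b, a, c)` with those of `(b, d, c)`.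
All of these are near `x`, so it is bounded, and the quasi-möbius inequality bounds the
corresponding quantity in `Y`. -/
theorem exists_dist_centers_le_of_replace (hX : IsGeodesicSpace X) (hY : IsGeodesicSpace Y)
    (hκY : IsInternalConstantChoice r κY) (hst : IsTwoStable h) (hqm : IsQuasiMoebius κX κY h)
    (N : MorseGauge) (K K' : ℝ) :
    ∃ C, ∀ (x : X) (a b c d : MorseBoundary p), PairMorse N a b → PairMorse N a c →
      PairMorse N b c → PairMorse N d a → PairMorse N d b → PairMorse N d c →
      x ∈ centers K a b c → x ∈ centers K d b c →
      ∀ y ∈ centers K' (h a) (h b) (h c), ∀ y' ∈ centers K' (h d) (h b) (h c), dist y y' ≤ C := by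
  obtain ⟨N', hN'⟩ := hst N
  obtain ⟨ψ, -, hψ, hcr⟩ := hqm N N' hN'
  have hκ := hκY N' (exists_isInternalConstant hY r N')
  set B₁ := centersConst N (max K (κX N))
  set B₂ := centersConst N' (max K' (κY N'))
  refine ⟨max B₂ (B₂ + ψ (B₁ + B₁).toNNReal + B₂), ?_⟩
  intro x a b c d mab mac mbc mda mdb mdc hx hx' y hy y' hy'
  have nab := (mem_centers.1 hx).1.ne
  have nbc := (mem_centers.1 hx).2.1.ne
  have nac := (mem_centers.1 hx).2.2.ne
  have ndb := (mem_centers.1 hx').1.ne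
  have ndc := (mem_centers.1 hx').2.2.ne
  have jab := hN'.pair nab mab
  have jac := hN'.pair nac mac
  have jbc := hN'.pair nbc mbc
  have jdb := hN'.pair ndb mdb
  have jdc := hN'.pair ndc mdc
  have hbY : ∀ u v w : MorseBoundary p, PairMorse N' (h u) (h v) → PairMorse N' (h v) (h w) →
      PairMorse N' (h u) (h w) → ∀ z ∈ centers K' (h u) (h v) (h w),
      ∀ z' ∈ centers (κY N') (h u) (h v) (h w), dist z z' ≤ B₂ :=
    fun u v w h1 h2 h3 z hz z' hz' => dist_le_of_mem_centers hY h1 h2 h3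
      (centers_mono (le_max_left _ _) _ _ _ hz) (centers_mono (le_max_right _ _) _ _ _ hz')
  have hbX : ∀ u v w : MorseBoundary p, PairMorse N u v → PairMorse N v w → PairMorse N u w →
      x ∈ centers K u v w → ∀ z ∈ centers (κX N) u v w, dist x z ≤ B₁ :=
    fun u v w h1 h2 h3 hx z hz => dist_le_of_mem_centers hX h1 h2 h3
      (centers_mono (le_max_left _ _) _ _ _ hx) (centers_mono (le_max_right _ _) _ _ _ hz)
  -- Cross-ratios require four distinct points; for `d = a` both points are centers of the same
  -- triple.
  rcases eq_or_ne a d with rfl | nad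
  · exact (dist_le_of_mem_centers hY jab.2 jbc.2 jac.2 (centers_mono (le_max_left _ _) _ _ _ hy)
      (centers_mono (le_max_left _ _) _ _ _ hy')).trans (le_max_left _ _)
  refine le_trans ?_ (le_max_right _ _)
  obtain ⟨z, hz⟩ := centers_nonempty hY hκ jab.1 jbc.1 jac.1 jab.2 jbc.2 jac.2
  obtain ⟨z', hz'⟩ := centers_nonempty hY hκ jdb.1 jbc.1 jdc.1 jdb.2 jbc.2 jdc.2
  have h₁ := hbY a b c jab.2 jbc.2 jac.2 y hy z hz
  have h₂ := hbY d b c jdb.2 jbc.2 jdc.2 y' hy' z' hz'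
  have h₃ : crossRatio (κX N) b a c d ≤ (B₁ + B₁).toNNReal := by
    rw [← NNReal.coe_le_coe]
    refine le_trans (b := max (B₁ + B₁) 0) ?_ (Real.coe_toNNReal' _).ge
    refine Metric.diam_le_of_forall_dist_le (le_max_right _ _) ?_
    have hall : ∀ w ∈ centers (κX N) b a c ∪ centers (κX N) b d c, dist x w ≤ B₁ := by
      rw [centers_swap_left _ b a, centers_swap_left _ b d]
      rintro w (hw | hw)
      · exact hbX a b c mab mbc mac hx w hw
      · exact hbX d b c mdb mbc mdc hx' w hw
    intro w hw w' hw'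
    have := dist_triangle_left w w' x
    exact le_trans (by linarith [hall w hw, hall w' hw']) (le_max_left _ _)
  have h₄ := (hcr b a c d (quadruple_mem_morseTuples nab.symm nbc ndb.symm nac nad ndc.symm
    mab.symm mbc mdb.symm mac mda.symm mdc.symm)).trans (hψ h₃)
  have h₅ : dist z z' ≤ crossRatio (κY N') (h b) (h a) (h c) (h d) := by
    refine Metric.dist_le_diam_of_mem ?_ (Or.inl (by rwa [centers_swap_left]))
      (Or.inr (by rwa [centers_swap_left]))
    rw [centers_swap_left _ (h b) (h a), centers_swap_left _ (h b) (h d)]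
    -- Boundedness is essential here, since `Metric.diam` of an unbounded set is 0.
    refine Bornology.IsBounded.union ?_ ?_
    · refine (Metric.isBounded_closedBall (x := y) (r := B₂)).subset fun w hw => ?_
      rw [Metric.mem_closedBall']
      exact hbY a b c jab.2 jbc.2 jac.2 y hy w hw
    · refine (Metric.isBounded_closedBall (x := y') (r := B₂)).subset fun w hw => ?_
      rw [Metric.mem_closedBall']
      exact hbY d b c jdb.2 jbc.2 jdc.2 y' hy' w hw
  have h₆ : dist z z' ≤ ψ (B₁ + B₁).toNNReal := h₅.trans (NNReal.coe_le_coe.2 h₄)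
  have h₇ := dist_triangle4 y z z' y'
  rw [dist_comm z' y'] at h₇
  linarith

/-- If `x` is a center of two Morse triples, then the centers of their images are uniformly
close. -/
theorem exists_dist_centers_le [ProperSpace X] (hX : IsGeodesicSpace X) (hY : IsGeodesicSpace Y)
    (hκY : IsInternalConstantChoice r κY) (hst : IsTwoStable h) (hqm : IsQuasiMoebius κX κY h)
    (N : MorseGauge) (K K' : ℝ) :
    ∃ C, ∀ (x : X) (T T' : Fin 3 → MorseBoundary p),
      (∀ i j, i ≠ j → PairMorse N (T i) (T j)) → (∀ i j, i ≠ j → PairMorse N (T' i) (T' j)) →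
      (∀ i j, i ≠ j → NearLine K x (T i) (T j)) → (∀ i j, i ≠ j → NearLine K x (T' i) (T' j)) →
      ∀ y y' : Y, (∀ i j, i ≠ j → NearLine K' y (h (T i)) (h (T j))) →
        (∀ i j, i ≠ j → NearLine K' y' (h (T' i)) (h (T' j))) → dist y y' ≤ C := by
  set M := lineGauge (realGauge N) (2 * K) with hM
  set δ := slimConst M
  have hδ : 0 ≤ δ := slimConst_nonneg M
  obtain ⟨M', hM'⟩ := hst M
  have hκ := hκY M' (exists_isInternalConstant hY r M')
  obtain ⟨C, hC⟩ := exists_dist_centers_le_of_replace hX hY hκY hst hqm M (K + δ)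
    (max K' (κY M'))
  refine ⟨C + C + C, fun x T T' mT mT' nT nT' y y' hy hy' => ?_⟩
  have aT : ∀ i, Anchored (realGauge N) K x (T i) := fun i =>
    (nT i (i + 1) (by decide +revert)).anchored (mT i (i + 1) (by decide +revert))
  have aT' : ∀ i, Anchored (realGauge N) K x (T' i) := fun i =>
    (nT' i (i + 1) (by decide +revert)).anchored (mT' i (i + 1) (by decide +revert))
  have mm : ∀ {u v : MorseBoundary p}, Anchored (realGauge N) K x u → Anchored (realGauge N) K x v →
      PairMorse M u v := fun hu hv => hu.pairMorse hX hv
  -- Both hypotheses are slimness: a line between two vertices of one triple passes near `x`, and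
  -- the third vertex of the triangle is taken from the other triple.
  obtain ⟨σ, hσ, hE⟩ := exists_matching (E := fun i k => NearLine (K + δ) x (T i) (T' k))
    (fun i j k hij => ((nT i j hij).or hX (T' k) (mm (aT i) (aT' k)) (mm (aT' k) (aT j))).imp_right
      NearLine.symm)
    (fun i k l hkl => ((nT' k l hkl).or hX (T i) (mm (aT' k) (aT i)) (mm (aT i) (aT' l))).imp_left
      NearLine.symm)
  have nσ : ∀ i j, i ≠ j → NearLine (K + δ) x (T' (σ i)) (T' (σ j)) := fun i j hij =>
    (nT' _ _ (hσ.ne hij)).mono (by linarith)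
  have nT₁ : ∀ i j, i ≠ j → NearLine (K + δ) x (T i) (T j) := fun i j hij =>
    (nT i j hij).mono (by linarith)
  have hc : ∀ {u v w : MorseBoundary p}, Anchored (realGauge N) K x u →
      Anchored (realGauge N) K x v → Anchored (realGauge N) K x w →
      x ∈ centers (K + δ) u v w →
        (centers (max K' (κY M')) (h u) (h v) (h w)).Nonempty := by
    intro u v w hu hv hw hx
    obtain ⟨h1, h2, h3⟩ := mem_centers.1 hx
    have j1 := hM'.pair h1.ne (mm hu hv)
    have j2 := hM'.pair h2.ne (mm hv hw)
    have j3 := hM'.pair h3.ne (mm hu hw)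
    exact (centers_nonempty hY hκ j1.1 j2.1 j3.1 j1.2 j2.2 j3.2).mono
      (centers_mono (le_max_right _ _) _ _ _)
  have step : ∀ {a b c d : MorseBoundary p}, Anchored (realGauge N) K x a →
      Anchored (realGauge N) K x b → Anchored (realGauge N) K x c → Anchored (realGauge N) K x d →
      x ∈ centers (K + δ) a b c → x ∈ centers (K + δ) d b c →
      ∀ y ∈ centers (max K' (κY M')) (h a) (h b) (h c),
      ∀ y' ∈ centers (max K' (κY M')) (h d) (h b) (h c), dist y y' ≤ C :=
    fun ha hb hc hd => hC x _ _ _ _ (mm ha hb) (mm ha hc) (mm hb hc) (mm hd ha) (mm hd hb)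
      (mm hd hc)
  -- The vertices are exchanged one by one; `hE` is only needed off the diagonal, because `T i` and
  -- `T' (σ i)` never occur in the same triple.
  have x₀ : x ∈ centers (K + δ) (T 0) (T 1) (T 2) := mem_centers_iff_forall.2 nT₁
  have x₁ : x ∈ centers (K + δ) (T' (σ 0)) (T 1) (T 2) := mem_centers.2
    ⟨(hE 1 0 (by decide)).symm, nT₁ 1 2 (by decide), (hE 2 0 (by decide)).symm⟩
  have x₂ : x ∈ centers (K + δ) (T' (σ 0)) (T' (σ 1)) (T 2) := mem_centers.2
    ⟨nσ 0 1 (by decide), (hE 2 1 (by decide)).symm, (hE 2 0 (by decide)).symm⟩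
  have x₃ : x ∈ centers (K + δ) (T' (σ 0)) (T' (σ 1)) (T' (σ 2)) :=
    mem_centers_iff_forall (T := fun i => T' (σ i)).2 nσ
  have y₀ : y ∈ centers (max K' (κY M')) (h (T 0)) (h (T 1)) (h (T 2)) :=
    mem_centers_iff_forall (T := fun i => h (T i)).2 fun i j hij =>
      (hy i j hij).mono (le_max_left _ _)
  have y₃ : y' ∈ centers (max K' (κY M')) (h (T' (σ 0))) (h (T' (σ 1))) (h (T' (σ 2))) :=
    mem_centers_iff_forall (T := fun i => h (T' (σ i))).2 fun i j hij =>
      (hy' _ _ (hσ.ne hij)).mono (le_max_left _ _)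
  obtain ⟨z₁, y₁⟩ := hc (aT' _) (aT _) (aT _) x₁
  obtain ⟨z₂, y₂⟩ := hc (aT' _) (aT' _) (aT _) x₂
  have d₁ := step (aT _) (aT _) (aT _) (aT' _) x₀ x₁ y y₀ z₁ y₁
  have d₂ := step (aT 1) (aT' (σ 0)) (aT 2) (aT' (σ 1)) (by rwa [centers_swap_left])
    (by rwa [centers_swap_left]) z₁ (by rwa [centers_swap_left]) z₂ (by rwa [centers_swap_left])
  have d₃ := step (aT 2) (aT' (σ 0)) (aT' (σ 1)) (aT' (σ 2))
    (by rwa [centers_swap_left, centers_swap_right]) (by rwa [centers_swap_left, centers_swap_right])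
    z₂ (by rwa [centers_swap_left, centers_swap_right]) y'
    (by rwa [centers_swap_left, centers_swap_right])
  have := dist_triangle4 y z₁ z₂ y'
  linarith

end Centers

/-! ### Coarse center maps -/

/-- `f` sends each `x` to a point within `D` of some `K'`-center of the image under `h` of an
`N`-Morse triple that has `x` as a `K`-center. -/
def IsCoarseCenterMap (h : MorseBoundary p → MorseBoundary r) (N : MorseGauge) (K K' D : ℝ)
    (f : X → Y) : Prop :=
  ∀ x, ∃ T : Fin 3 → MorseBoundary p, (∀ i j, i ≠ j → PairMorse N (T i) (T j)) ∧
    (∀ i j, i ≠ j → NearLine K x (T i) (T j)) ∧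
      ∃ y, dist (f x) y ≤ D ∧ ∀ i j, i ≠ j → NearLine K' y (h (T i)) (h (T j))

theorem coveredByCenters_iff {N : MorseGauge} {K : ℝ} : CoveredByCenters p N K ↔
    ∀ x : X, ∃ T : Fin 3 → MorseBoundary p, (∀ i j, i ≠ j → PairMorse N (T i) (T j)) ∧
      ∀ i j, i ≠ j → NearLine K x (T i) (T j) := by
  refine forall_congr' fun x => ⟨?_, ?_⟩
  · rintro ⟨a, b, c, hm, hx⟩
    exact ⟨![a, b, c], hm.2, mem_centers_iff_forall (T := ![a, b, c]).1 hx⟩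
  · rintro ⟨T, hm, hx⟩
    refine ⟨T 0, T 1, T 2, ?_, mem_centers_iff_forall.2 hx⟩
    have : ![T 0, T 1, T 2] = T := by ext i; fin_cases i <;> rfl
    rw [this]
    exact mem_morseTuples_iff.2 fun i j hij => ⟨(hx i j hij).ne, hm i j hij⟩

theorem CoveredByCenters.mono {N N' : MorseGauge} {K K' : ℝ} (h : CoveredByCenters p N K)
    (hN : N ≤ N') (hK : K ≤ K') : CoveredByCenters p N' K' := by
  rw [coveredByCenters_iff] at h ⊢
  intro x
  obtain ⟨T, h1, h2⟩ := h x
  exact ⟨T, fun i j hij => (h1 i j hij).mono hN, fun i j hij => (h2 i j hij).mono hK⟩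

theorem exists_image_center [ProperSpace Y] (hY : IsGeodesicSpace Y) {N N' : MorseGauge}
    {K κ : ℝ} (hκ : IsInternalConstant r N' κ) {h : MorseBoundary p → MorseBoundary r}
    (hm : MapsTuples 3 N N' h) {x : X} {T : Fin 3 → MorseBoundary p}
    (hT : ∀ i j, i ≠ j → PairMorse N (T i) (T j)) (hx : ∀ i j, i ≠ j → NearLine K x (T i) (T j)) :
    ∃ y, ∀ i j, i ≠ j → NearLine κ y (h (T i)) (h (T j)) := by
  have h1 := mem_morseTuples_iff.1 (hm T (mem_morseTuples_iff.2 fun i j hij =>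
    ⟨(hx i j hij).ne, hT i j hij⟩))
  obtain ⟨y, hy⟩ := centers_nonempty hY hκ (h1 0 1 (by decide)).1 (h1 1 2 (by decide)).1
    (h1 0 2 (by decide)).1 (h1 0 1 (by decide)).2 (h1 1 2 (by decide)).2 (h1 0 2 (by decide)).2
  exact ⟨y, mem_centers_iff_forall (T := fun i => h (T i)).1 hy⟩

/-- Only the basepoint needs the error `D`: its prescribed image `r` need not be a center. -/
theorem IsCenterMap.isCoarseCenterMap [ProperSpace Y] (hY : IsGeodesicSpace Y)
    {h : MorseBoundary p → MorseBoundary r} {N N' : MorseGauge} {K : ℝ} {f : X → Y}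
    (hf : IsCenterMap h N K f) (hκ : IsInternalConstant r N' K) (hm : MapsTuples 3 N N' h)
    (hc : CoveredByCenters p N K) : ∃ D, IsCoarseCenterMap h N K K D f := by
  obtain ⟨T, hT, hx⟩ := coveredByCenters_iff.1 hc p
  obtain ⟨y, hy⟩ := exists_image_center hY hκ hm hT hx
  refine ⟨dist (f p) y, fun x => ?_⟩
  rcases eq_or_ne x p with rfl | hxp
  · exact ⟨T, hT, hx, y, le_rfl, hy⟩
  · obtain ⟨a, b, c, habc, h1, h2⟩ := hf.2 x hxp
    refine ⟨![a, b, c], habc.2, mem_centers_iff_forall (T := ![a, b, c]).1 h1, f x, by simp, ?_⟩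
    exact mem_centers_iff_forall (T := fun i => h (![a, b, c] i)).1 h2

theorem exists_dist_le_mul_add (hX : IsGeodesicSpace X) {f : X → Y} {C : ℝ}
    (hf : ∀ x y, dist x y ≤ 1 → dist (f x) (f y) ≤ C) (x y : X) :
    dist (f x) (f y) ≤ C * dist x y + C := by
  have hC : 0 ≤ C := dist_nonneg.trans (hf x x (by simp))
  have key : ∀ n : ℕ, ∀ x y, dist x y ≤ n → dist (f x) (f y) ≤ C * n := by
    intro n
    induction n with
    | zero =>
      intro x y h
      rw [Nat.cast_zero] at h
      simp [dist_le_zero.1 h]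
    | succ n ih =>
      intro x y h
      push_cast at h ⊢
      obtain ⟨γ, h0, h1, hγ⟩ := hX x y
      have hγ : IsGeodesicOn γ (Icc 0 (dist x y)) := hγ
      have hd : 0 ≤ dist x y := dist_nonneg
      have ht : max 0 (dist x y - 1) ∈ Icc 0 (dist x y) :=
        ⟨le_max_left _ _, max_le hd (by linarith)⟩
      have h2 := hγ.of_le ⟨le_rfl, hd⟩ ht ht.1
      have h3 := hγ.of_le ht ⟨hd, le_rfl⟩ ht.2
      rw [h0] at h2
      rw [h1] at h3
      have h4 := ih x (γ (max 0 (dist x y - 1))) (by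
        rw [h2, sub_zero]
        exact max_le n.cast_nonneg (by linarith))
      have h5 := hf (γ (max 0 (dist x y - 1))) y (by
        rw [h3]
        linarith [le_max_right 0 (dist x y - 1)])
      have h6 := dist_triangle (f x) (f (γ (max 0 (dist x y - 1)))) (f y)
      linarith
  refine (key ⌈dist x y⌉₊ x y (Nat.le_ceil _)).trans ?_
  have := (Nat.ceil_lt_add_one (dist_nonneg (x := x) (y := y))).le
  nlinarith

/-- The lower bound for `f` is the coarse Lipschitz bound for `g`, applied to `f x` and `f y`. -/
theorem isQuasiIsometry_of_coarse_inverse (hX : IsGeodesicSpace X) (hY : IsGeodesicSpace Y)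
    {f : X → Y} {g : Y → X} {C₁ C₂ D₁ D₂ : ℝ} (hf : ∀ x y, dist x y ≤ 1 → dist (f x) (f y) ≤ C₁)
    (hg : ∀ x y, dist x y ≤ 1 → dist (g x) (g y) ≤ C₂) (hgf : ∀ x, dist (g (f x)) x ≤ D₁)
    (hfg : ∀ y, dist (f (g y)) y ≤ D₂) : IsQuasiIsometry f := by
  refine ⟨⟨max 1 (max C₁ C₂), max 0 (max C₁ (C₂ + 2 * D₁)), le_max_left _ _, le_max_left _ _, ?_⟩,
    g, max 0 (max D₁ D₂), le_max_left _ _,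
    fun x => (hgf x).trans ((le_max_left _ _).trans (le_max_right _ _)),
    fun y => (hfg y).trans ((le_max_right _ _).trans (le_max_right _ _))⟩
  intro x _ y _
  set l := max 1 (max C₁ C₂)
  set e := max 0 (max C₁ (C₂ + 2 * D₁))
  have hl : 1 ≤ l := le_max_left _ _
  have hl₁ : C₁ ≤ l := (le_max_left _ _).trans (le_max_right _ _)
  have hl₂ : C₂ ≤ l := (le_max_right _ _).trans (le_max_right _ _)
  have he₁ : C₁ ≤ e := (le_max_left _ _).trans (le_max_right _ _)
  have he₂ : C₂ + 2 * D₁ ≤ e := (le_max_right _ _).trans (le_max_right _ _)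
  have he : 0 ≤ e := le_max_left _ _
  have h1 := exists_dist_le_mul_add hX hf x y
  have h2 := exists_dist_le_mul_add hY hg (f x) (f y)
  have h3 := dist_triangle4 x (g (f x)) (g (f y)) y
  have h4 := hgf x
  have h5 := hgf y
  rw [dist_comm x (g (f x))] at h3
  have h6 : 0 ≤ dist x y := dist_nonneg
  have h7 : 0 ≤ dist (f x) (f y) := dist_nonneg
  rw [one_div_mul_sub_le_iff (by linarith)]
  constructor <;> nlinarith

section CoarseCenterMap

variable [ProperSpace X] [ProperSpace Y] {κX κY : MorseGauge → ℝ}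
  {h : MorseBoundary p → MorseBoundary r}

/-- If `dist x x' ≤ 1`, a triple with `K`-center `x'` has `x` as a `(K + 1)`-center, so both image
centers belong to triples centered at `x`. -/
theorem IsCoarseCenterMap.exists_dist_le (hX : IsGeodesicSpace X) (hY : IsGeodesicSpace Y)
    (hκY : IsInternalConstantChoice r κY) (hst : IsTwoStable h) (hqm : IsQuasiMoebius κX κY h)
    {N : MorseGauge} {K K' D : ℝ} {f : X → Y} (hf : IsCoarseCenterMap h N K K' D f) :
    ∃ C, ∀ x x', dist x x' ≤ 1 → dist (f x) (f x') ≤ C := by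
  obtain ⟨C, hC⟩ := exists_dist_centers_le hX hY hκY hst hqm N (K + 1) K'
  refine ⟨D + C + D, fun x x' hxx' => ?_⟩
  obtain ⟨T, hT, hx, y, hy, hy'⟩ := hf x
  obtain ⟨T', hT', hx', z, hz, hz'⟩ := hf x'
  have := hC x T T' hT hT' (fun i j hij => (hx i j hij).mono (by linarith))
    (fun i j hij => (hx' i j hij).move hxx') y z hy' hz'
  have h1 := dist_triangle4 (f x) y z (f x')
  rw [dist_comm z] at h1
  linarith

/-- The point `f x` is a coarse center of `h T` and of the triple `S` used to define `g (f x)`.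
Applying `h'` to both triples compares `g (f x)` with a center of `h' (h T) = T`, for which `x`
itself serves. -/
theorem IsCoarseCenterMap.exists_dist_comp_le (hX : IsGeodesicSpace X) (hY : IsGeodesicSpace Y)
    (hκX : IsInternalConstantChoice p κX) {h' : MorseBoundary r → MorseBoundary p}
    (hst : IsTwoStable h) (hst' : IsTwoStable h') (hqm' : IsQuasiMoebius κY κX h')
    (hh : ∀ a, h' (h a) = a) {N M : MorseGauge} {K K' D L L' E : ℝ}
    {f : X → Y} {g : Y → X} (hf : IsCoarseCenterMap h N K K' D f)
    (hg : IsCoarseCenterMap h' M L L' E g) : ∃ C, ∀ x, dist (g (f x)) x ≤ C := by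
  obtain ⟨N', hN'⟩ := hst N
  obtain ⟨C, hC⟩ := exists_dist_centers_le hY hX hκX hst' hqm' (M ⊔ N') (max L (K' + D)) (max L' K)
  refine ⟨E + C, fun x => ?_⟩
  obtain ⟨T, hT, hx, y, hy, hy'⟩ := hf x
  obtain ⟨S, hS, hx', z, hz, hz'⟩ := hg (f x)
  have h1 := hC (f x) S (fun i => h (T i)) (fun i j hij => (hS i j hij).mono le_sup_left)
    (fun i j hij => (hN'.pair (hx i j hij).ne (hT i j hij)).2.mono le_sup_right)
    (fun i j hij => (hx' i j hij).mono (le_max_left _ _))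
    (fun i j hij => ((hy' i j hij).move hy).mono (le_max_right _ _)) z x
    (fun i j hij => (hz' i j hij).mono (le_max_left _ _))
    (fun i j hij => by simpa only [hh] using (hx i j hij).mono (le_max_right _ _))
  linarith [dist_triangle (g (f x)) z x]

/-- The image under a coarse center map of a ray to `a` stays close to lines from `h a`. -/
theorem IsCoarseCenterMap.exists_nearLine (hX : IsGeodesicSpace X) (hY : IsGeodesicSpace Y)
    (hκY : IsInternalConstantChoice r κY) (hst : IsTwoStable h) (hqm : IsQuasiMoebius κX κY h)
    {N : MorseGauge} {K K' D : ℝ} {f : X → Y} (hf : IsCoarseCenterMap h N K K' D f)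
    {a b : MorseBoundary p} (hab : a ≠ b) {ρ : ℝ → X} (hρ : IsRayTo ρ a) :
    ∃ C, ∀ t, 0 ≤ t → NearLine C (f (ρ t)) (h a) (h b) := by
  obtain ⟨γ, hγ⟩ := exists_isLineFromTo hX hab.symm
  obtain ⟨N₀, hN₀⟩ := exists_isMorse_lines hX b a
  have hN₀ : PairMorse N₀ b a := hN₀
  obtain ⟨D₀, hD₀⟩ := hρ.exists_dist_le (hγ.isRayTo_right 0)
  set g : ℝ → ℝ → ℝ := fun l e => max (realGauge N l e) (realGauge N₀ l e)
  set K₁ := max K D₀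
  set M := lineGauge g (2 * K₁)
  have hδ : 0 ≤ slimConst M := slimConst_nonneg M
  obtain ⟨M', hM'⟩ := hst (M ⊔ N)
  have hκ := hκY M' (exists_isInternalConstant hY r M')
  obtain ⟨C, hC⟩ := exists_dist_centers_le hX hY hκY hst hqm (M ⊔ N) (K₁ + slimConst M)
    (max K' (κY M'))
  refine ⟨κY M' + (C + D), fun t ht => ?_⟩
  obtain ⟨T, hT, hx, y, hy, hy'⟩ := hf (ρ t)
  have hba : NearLine K₁ (ρ t) b a := ⟨γ, hγ, _, (hD₀ t ht).trans (le_max_right _ _)⟩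
  have ha : Anchored g K₁ (ρ t) a :=
    (hba.symm.anchored hN₀.symm).mono (fun _ _ => le_max_right _ _) le_rfl
  have hb : Anchored g K₁ (ρ t) b :=
    (hba.anchored hN₀).mono (fun _ _ => le_max_right _ _) le_rfl
  have hTa : ∀ i, Anchored g K₁ (ρ t) (T i) := fun i =>
    ((hx i (i + 1) (by decide +revert)).anchored (hT i (i + 1) (by decide +revert))).mono
      (fun _ _ => le_max_left _ _) (le_max_left _ _)
  have hor : ∀ u, Anchored g K₁ (ρ t) u → ∀ i j, i ≠ j →
      NearLine (K₁ + slimConst M) (ρ t) (T i) u ∨ NearLine (K₁ + slimConst M) (ρ t) (T j) u :=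
    fun u hu i j hij => (((hx i j hij).mono (le_max_left _ _)).or hX u ((hTa i).pairMorse hX hu)
      (hu.pairMorse hX (hTa j))).imp_right NearLine.symm
  -- By slimness at most one vertex of `T` fails for `a` and at most one for `b`, so one of the
  -- three works for both.
  obtain ⟨k, hka, hkb⟩ : ∃ k, NearLine (K₁ + slimConst M) (ρ t) (T k) a ∧
      NearLine (K₁ + slimConst M) (ρ t) (T k) b := by
    by_contra! hne
    have h01 := hor a ha 0 1 (by decide)
    have h12 := hor a ha 1 2 (by decide)
    have h02 := hor a ha 0 2 (by decide)
    have k01 := hor b hb 0 1 (by decide)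
    have k12 := hor b hb 1 2 (by decide)
    have k02 := hor b hb 0 2 (by decide)
    have h0 := hne 0
    have h1 := hne 1
    have h2 := hne 2
    tauto
  set S : Fin 3 → MorseBoundary p := ![a, b, T k] with hS
  have hSa : ∀ i, Anchored g K₁ (ρ t) (S i) := by
    intro i
    fin_cases i
    exacts [ha, hb, hTa k]
  have hSM : ∀ i j, i ≠ j → PairMorse (M ⊔ N) (S i) (S j) := fun i j _ =>
    ((hSa i).pairMorse hX (hSa j)).mono le_sup_left
  have hSx : ∀ i j, i ≠ j → NearLine (K₁ + slimConst M) (ρ t) (S i) (S j) :=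
    mem_centers_iff_forall.1 (mem_centers.2 ⟨hba.symm.mono (by linarith), hkb.symm, hka.symm⟩)
  obtain ⟨z, hz⟩ := exists_image_center hY hκ (hM'.of_two 3) hSM hSx
  have h1 := hC (ρ t) T S (fun i j hij => (hT i j hij).mono le_sup_right) hSM
    (fun i j hij => (hx i j hij).mono (by linarith [le_max_left K D₀])) hSx y z
    (fun i j hij => (hy' i j hij).mono (le_max_left _ _))
    (fun i j hij => (hz i j hij).mono (le_max_right _ _))
  refine (hz 0 1 (by decide)).move ?_
  linarith [dist_triangle (f (ρ t)) y z]

end CoarseCenterMap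

/-! ### The induced boundary map -/

/-- Points that are close to lines from `a` to two further points are close to rays to `a`. -/
theorem exists_near_ray_of_nearLine [ProperSpace X] (hX : IsGeodesicSpace X)
    {a b c : MorseBoundary p} (hab : a ≠ b) (hac : a ≠ c) (hbc : b ≠ c) {σ : ℝ → X}
    (hσ : IsRayTo σ a) (K : ℝ) :
    ∃ D, ∀ y : X, NearLine K y a b → NearLine K y a c → ∃ s, 0 ≤ s ∧ dist y (σ s) ≤ D := by
  obtain ⟨γ₁, h₁⟩ := exists_isLineFromTo hX hab
  obtain ⟨γ₂, h₂⟩ := exists_isLineFromTo hX hac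
  obtain ⟨γ₃, h₃⟩ := exists_isLineFromTo hX hbc
  obtain ⟨N₁, m₁⟩ := exists_isMorse_lines hX a b
  obtain ⟨N₂, m₂⟩ := exists_isMorse_lines hX a c
  obtain ⟨D₁, hD₁⟩ := (h₁.isRayTo_left 0).exists_dist_le hσ
  obtain ⟨D₂, hD₂⟩ := (h₂.isRayTo_left 0).exists_dist_le hσ
  set g : ℝ → ℝ → ℝ := fun l e => max (realGauge N₁ l e) (realGauge N₂ l e)
  set K₁ := max (K + g 9 4) (max (dist (γ₁ 0) (γ₂ 0)) (dist (γ₁ 0) (γ₃ 0)))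
  have hK₁ : K + g 9 4 ≤ K₁ := le_max_left _ _
  have hK₁0 : 0 ≤ K₁ := dist_nonneg.trans ((le_max_left _ _).trans (le_max_right _ _))
  have hg₁ : realGauge N₁ 9 4 ≤ g 9 4 := le_max_left _ _
  have hg₂ : realGauge N₂ 9 4 ≤ g 9 4 := le_max_right _ _
  refine ⟨max (K₁ + max D₁ D₂) (4 * K₁ + unionGauge g (2 * K₁) 9 4 + D₁), fun y hy₁ hy₂ => ?_⟩
  obtain ⟨s, hs⟩ := hy₁.near hX h₁ (m₁ γ₁ h₁)
  obtain ⟨t, ht⟩ := hy₂.near hX h₂ (m₂ γ₂ h₂)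
  have hleft : ∀ {γ : ℝ → X} {u D : ℝ}, (∀ t, 0 ≤ t → dist (γ (0 - t)) (σ t) ≤ D) →
      dist y (γ u) ≤ K₁ → u ≤ 0 → ∃ s, 0 ≤ s ∧ dist y (σ s) ≤ K₁ + D := by
    intro γ u D hD hu hu0
    have := hD (-u) (by linarith)
    rw [sub_neg_eq_add, zero_add] at this
    exact ⟨-u, by linarith, (dist_triangle _ _ _).trans (add_le_add hu this)⟩
  rcases le_total s 0 with hs0 | hs0
  · obtain ⟨w, hw, hd⟩ := hleft hD₁ (by linarith) hs0
    exact ⟨w, hw, hd.trans (le_max_of_le_left (by gcongr; exact le_max_left _ _))⟩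
  rcases le_total t 0 with ht0 | ht0
  · obtain ⟨w, hw, hd⟩ := hleft hD₂ (by linarith) ht0
    exact ⟨w, hw, hd.trans (le_max_of_le_left (by gcongr; exact le_max_right _ _))⟩
  -- In the remaining case `y` is beyond `γ₁ 0` towards `b` and beyond `γ₂ 0` towards `c`. As `γ₃`
  -- joins `b` and `c` at bounded distance from `γ₁ 0`, `y` must stay near `γ₁ 0`.
  have key := dist_le_of_between hX (g := g) (K := K₁) (x := γ₁ 0) (y := y) (h₁.isRayTo_right 0)
    (h₂.isRayTo_right 0) (((m₁ γ₁ h₁).morseRay_right 0).mono fun _ _ _ _ => le_max_left _ _)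
    (((m₂ γ₂ h₂).morseRay_right 0).mono fun _ _ _ _ => le_max_right _ _) (by simpa using hK₁0)
    (by rw [add_zero]; exact (le_max_left _ _).trans (le_max_right _ _))
    ⟨s, hs0, by rw [zero_add]; linarith⟩ ⟨t, ht0, by rw [zero_add]; linarith⟩
    ⟨γ₃, h₃, 0, (le_max_right _ _).trans (le_max_right _ _)⟩
  refine ⟨0, le_rfl, le_trans ?_ (le_max_right _ _)⟩
  have h4 := hD₁ 0 le_rfl
  rw [sub_zero] at h4
  have h5 := dist_triangle y (γ₁ 0) (σ 0)
  rw [dist_comm y (γ₁ 0)] at h5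
  linarith

/-- A quasi-isometrically embedded ray that stays in a neighbourhood of a geodesic ray with the
same starting point is at finite Hausdorff distance from it. -/
theorem finiteHausdorff_of_near_ray {l e D : ℝ} (hl : 1 ≤ l) {φ σ : ℝ → Y}
    (hφ : IsQIEmbeddingOn l e φ (Ici 0)) (hσ : IsGeodesicOn σ (Ici 0)) (h0 : φ 0 = σ 0)
    (h : ∀ t, 0 ≤ t → ∃ s, 0 ≤ s ∧ dist (φ t) (σ s) ≤ D) :
    FiniteHausdorff (φ '' Ici 0) (σ '' Ici 0) := by
  have hD : 0 ≤ D := by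
    obtain ⟨s, -, hs⟩ := h 0 le_rfl
    exact dist_nonneg.trans hs
  have he : 0 ≤ e := by
    have := (hφ.of_le (by linarith) self_mem_Ici self_mem_Ici (le_refl (0 : ℝ))).2
    simpa using this
  refine finiteHausdorff_of_dist_le (D := 2 * D + (l + e)) ?_ ?_
  · rintro _ ⟨t, ht, rfl⟩
    obtain ⟨s, hs, hd⟩ := h t ht
    exact ⟨σ s, mem_image_of_mem _ hs, by linarith⟩
  · rintro _ ⟨u, hu, rfl⟩
    rw [mem_Ici] at hu
    have hT : 0 ≤ l * (u + 1 + e) := by positivity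
    have hT' : ¬ dist (φ 0) (φ (l * (u + 1 + e))) ≤ u := by
      intro hle
      have := (hφ.of_le (by linarith) self_mem_Ici (mem_Ici.2 hT) hT).1
      nlinarith
    -- The path may be discontinuous, but within one unit of time it moves by at most `l + e`. So
    -- just after its distance from the start passes `u`, that distance is still about `u`, and the
    -- nearby point of `σ` has parameter close to `u`.
    obtain ⟨s, hs, t, ht, hst, hts, hPs, hPt⟩ := exists_change
      (P := fun t => dist (φ 0) (φ t) ≤ u) hT (by simpa using hu) hT' one_pos
    push Not at hPt
    have h1 := (hφ.of_le (by linarith) (mem_Ici.2 hs.1) (mem_Ici.2 ht.1) hst).2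
    have h2 := dist_triangle (φ 0) (φ s) (φ t)
    have h3 : dist (φ s) (φ t) ≤ l + e := by nlinarith
    obtain ⟨w, hw, hd⟩ := h t ht.1
    have h4 := hσ.of_le self_mem_Ici hw hw
    rw [← h0] at h4
    have h5 := dist_triangle (φ 0) (φ t) (σ w)
    have h6 := dist_triangle (φ 0) (σ w) (φ t)
    rw [dist_comm (σ w)] at h6
    have h7 : dist w u ≤ D + (l + e) := by
      rw [Real.dist_eq, abs_le]
      constructor <;> linarith
    refine ⟨φ t, mem_image_of_mem _ ht.1, ?_⟩
    have h8 := dist_triangle (σ u) (σ w) (φ t)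
    rw [hσ _ hu _ hw, dist_comm u, dist_comm (σ w)] at h8
    linarith

theorem IsCoarseCenterMap.isInducedBoundaryMap [ProperSpace X] [ProperSpace Y]
    (hX : IsGeodesicSpace X) (hY : IsGeodesicSpace Y) {κX κY : MorseGauge → ℝ}
    (hκY : IsInternalConstantChoice r κY) {h : MorseBoundary p → MorseBoundary r}
    (hinj : h.Injective) (hst : IsTwoStable h) (hqm : IsQuasiMoebius κX κY h)
    {N : MorseGauge} {K K' D : ℝ} {f : X → Y} (hf : IsCoarseCenterMap h N K K' D f)
    (hfp : f p = r) (hqi : IsQuasiIsometry f) : IsInducedBoundaryMap f h := by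
  refine ⟨hfp, fun a α β hα hβ => ?_⟩
  obtain ⟨b, c, hab, hac, hbc⟩ : ∃ b c : MorseBoundary p, a ≠ b ∧ a ≠ c ∧ b ≠ c := by
    obtain ⟨T, -, hT, -⟩ := hf p
    have h01 := (hT 0 1 (by decide)).ne
    have h02 := (hT 0 2 (by decide)).ne
    have h12 := (hT 1 2 (by decide)).ne
    by_cases h0 : a = T 0
    · exact ⟨T 1, T 2, h0 ▸ h01, h0 ▸ h02, h12⟩
    by_cases h1 : a = T 1
    · exact ⟨T 0, T 2, h0, h1 ▸ h12, h02⟩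
    · exact ⟨T 0, T 1, h0, h1, h01⟩
  have hρ := hα.isRayTo
  have hσ := hβ.isRayTo
  obtain ⟨C₁, hC₁⟩ := hf.exists_nearLine hX hY hκY hst hqm hab hρ
  obtain ⟨C₂, hC₂⟩ := hf.exists_nearLine hX hY hκY hst hqm hac hρ
  obtain ⟨E, hE⟩ := exists_near_ray_of_nearLine hY (hinj.ne hab) (hinj.ne hac) (hinj.ne hbc) hσ
    (max C₁ C₂)
  obtain ⟨⟨l, e, hl, -, hle⟩, -⟩ := hqi
  have h1 := finiteHausdorff_of_near_ray hl (φ := fun t => f (α.toFun t.toNNReal)) (e := e)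
    (D := E) (fun s hs t ht => by
      have := hle _ (mem_univ (α.toFun s.toNNReal)) _ (mem_univ (α.toFun t.toNNReal))
      rwa [hρ.1 s hs t ht] at this) hσ.1
    (by simp [α.map_zero, β.map_zero, hfp])
    fun t ht => hE _ ((hC₁ t ht).mono (le_max_left _ _)) ((hC₂ t ht).mono (le_max_right _ _))
  rw [image_toNNReal_Ici, image_toNNReal_Ici (fun t => f (α.toFun t))] at h1
  rwa [← range_comp]

/-! ### Construction data and existence of center maps -/

theorem IsInternalConstant.mono {N : MorseGauge} {K K' : ℝ} (h : IsInternalConstant p N K)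
    (hK : K ≤ K') : IsInternalConstant p N K' := by
  refine ⟨h.1.trans_le hK, fun a b c γab γbc γac ht h1 h2 h3 => ?_⟩
  obtain ⟨s, t, u, h4, h5, h6⟩ := h.2 a b c γab γbc γac ht h1 h2 h3
  exact ⟨s, t, u, h4.trans hK, h5.trans hK, h6.trans hK⟩

theorem exists_isConstructionData (hcX : IsMorseCenterSpace p) (hcY : IsMorseCenterSpace r)
    {h : MorseBoundary p → MorseBoundary r} (hst : IsTwoStable h) :
    ∃ N Nh K₀, IsConstructionData h N Nh K₀ := by
  obtain ⟨N₁, K₁, -, h₁⟩ := hcX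
  obtain ⟨N₂, K₂, -, h₂⟩ := hcY
  obtain ⟨N', hN'⟩ := hst (N₁ ⊔ N₂)
  refine ⟨N₁ ⊔ N₂, (N₁ ⊔ N₂) ⊔ N', max K₁ K₂, ?_, ?_, le_sup_left, ?_⟩
  · exact fun K hK => h₁.mono le_sup_left ((le_max_left _ _).trans hK)
  · exact fun K hK => h₂.mono le_sup_right ((le_max_right _ _).trans hK)
  · intro T hT
    obtain ⟨h3, h4⟩ := hN'.of_two 3 T hT
    exact ⟨h3, fun i j hij => PairMorse.mono (h4 i j hij) le_sup_right⟩

theorem exists_isCenterMap [ProperSpace Y] (hY : IsGeodesicSpace Y)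
    {h : MorseBoundary p → MorseBoundary r} {N N' : MorseGauge} {K : ℝ}
    (hκ : IsInternalConstant r N' K) (hm : MapsTuples 3 N N' h) (hc : CoveredByCenters p N K) :
    ∃ f : X → Y, IsCenterMap h N K f := by
  classical
  have key : ∀ x : X, ∃ (y : Y) (a b c : MorseBoundary p), ![a, b, c] ∈ morseTuples p 3 N ∧
      x ∈ centers K a b c ∧ y ∈ centers K (h a) (h b) (h c) := by
    intro x
    obtain ⟨a, b, c, hm', hx⟩ := hc x
    obtain ⟨y, hy⟩ := exists_image_center hY hκ hm hm'.2
      (mem_centers_iff_forall (T := ![a, b, c]).1 hx)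
    exact ⟨y, a, b, c, hm', hx, mem_centers_iff_forall (T := fun i => h (![a, b, c] i)).2 hy⟩
  choose f hf using key
  refine ⟨Function.update f p r, by simp, fun x hx => ?_⟩
  rw [Function.update_of_ne hx]
  exact hf x

/-- Without a basepoint condition no error is needed; applied to the inverse of `h`, this supplies
the quasi-inverse. -/
theorem exists_isCoarseCenterMap [ProperSpace Y] (hY : IsGeodesicSpace Y)
    {h : MorseBoundary p → MorseBoundary r} {N N' : MorseGauge} {K κ : ℝ}
    (hκ : IsInternalConstant r N' κ) (hm : MapsTuples 3 N N' h) (hc : CoveredByCenters p N K) :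
    ∃ f : X → Y, IsCoarseCenterMap h N K κ 0 f := by
  have key : ∀ x : X, ∃ (y : Y) (T : Fin 3 → MorseBoundary p),
      (∀ i j, i ≠ j → PairMorse N (T i) (T j)) ∧ (∀ i j, i ≠ j → NearLine K x (T i) (T j)) ∧
        ∀ i j, i ≠ j → NearLine κ y (h (T i)) (h (T j)) := by
    intro x
    obtain ⟨T, hT, hx⟩ := coveredByCenters_iff.1 hc x
    obtain ⟨y, hy⟩ := exists_image_center hY hκ hm hT hx
    exact ⟨y, T, hT, hx, hy⟩
  choose f T h1 h2 h3 using key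
  exact ⟨f, fun x => ⟨T x, h1 x, h2 x, f x, by simp, h3 x⟩⟩

end MorseBoundaries

open MorseBoundaries
theorem theorem4p3 {X Y : Type*} [MetricSpace X] [ProperSpace X] [MetricSpace Y] [ProperSpace Y]
    (hgX : IsGeodesicSpace X) (hgY : IsGeodesicSpace Y) (p : X) (r : Y)
    (κX κY : MorseGauge → ℝ)
    (hκX : IsInternalConstantChoice p κX) (hκY : IsInternalConstantChoice r κY)
    (hcX : IsMorseCenterSpace p) (hcY : IsMorseCenterSpace r)
    (hsX : HasSmallCrossRatios p κX) (hsY : HasSmallCrossRatios r κY)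
    (h : MorseBoundary p ≃ₜ MorseBoundary r)
    (hst : IsTwoStable h) (hst' : IsTwoStable h.symm)
    (hqm : IsQuasiMoebius κX κY h) (hqm' : IsQuasiMoebius κY κX h.symm) :
    (∃ N Nh K₀, IsConstructionData h N Nh K₀) ∧
      ∀ N Nh K₀, IsConstructionData h N Nh K₀ →
        (∀ K, max K₀ (κY Nh) ≤ K → ∃ f : X → Y, IsCenterMap h N K f) ∧
        ∃ K₁, max K₀ (κY Nh) ≤ K₁ ∧ ∀ K, K₁ ≤ K → ∀ f : X → Y, IsCenterMap h N K f →
          IsQuasiIsometry f ∧ IsInducedBoundaryMap f h := by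
  refine ⟨exists_isConstructionData hcX hcY hst, fun N Nh K₀ hdata => ?_⟩
  have hκ : ∀ K, max K₀ (κY Nh) ≤ K → IsInternalConstant r Nh K := fun K hK =>
    (hκY Nh (exists_isInternalConstant hgY r Nh)).mono ((le_max_right _ _).trans hK)
  have hcov : ∀ K, max K₀ (κY Nh) ≤ K → CoveredByCenters p N K := fun K hK =>
    hdata.coverX K ((le_max_left _ _).trans hK)
  refine ⟨fun K hK => exists_isCenterMap hgY (hκ K hK) hdata.maps (hcov K hK),
    max K₀ (κY Nh), le_rfl, fun K hK f hf => ?_⟩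
  obtain ⟨D, hfD⟩ := hf.isCoarseCenterMap hgY (hκ K hK) hdata.maps (hcov K hK)
  obtain ⟨N', hN'⟩ := hst' N
  -- The quasi-inverse may use its own constants: `K₀` for covering `Y` and the internal constant of
  -- `N'` in `X`, both unrelated to `K`.
  obtain ⟨g, hg⟩ := exists_isCoarseCenterMap hgX (hκX N' (exists_isInternalConstant hgX p N'))
    (hN'.of_two 3) (hdata.coverY K₀ le_rfl)
  obtain ⟨C₁, hC₁⟩ := hfD.exists_dist_le hgX hgY hκY hst hqm
  obtain ⟨C₂, hC₂⟩ := hg.exists_dist_le hgY hgX hκX hst' hqm'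
  obtain ⟨D₁, hD₁⟩ := hfD.exists_dist_comp_le hgX hgY hκX hst hst' hqm' h.symm_apply_apply hg
  obtain ⟨D₂, hD₂⟩ := hg.exists_dist_comp_le hgY hgX hκY hst' hst hqm h.apply_symm_apply hfD
  have hqi := isQuasiIsometry_of_coarse_inverse hgX hgY hC₁ hC₂ hD₁ hD₂
  exact ⟨hqi, hfD.isInducedBoundaryMap hgX hgY hκY h.injective hst hqm hf.1 hqi⟩
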